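/- **Model.** Let $\lambda,\beta,\rho>0$ and $c=\pi/\sqrt2$. For $L>0$ and a finite set of impurities in $(-L/2,L/2)$, let $L_1,\dots,L_n$ be the lengths of the $n$ intervals into which the impurities divide $[-L/2,L/2]$ (there are $n-1$ impurities), and let $E_s(\ell)=\pi^2s^2/(2\ell^2)$, $s\ge1$, be the eigenvalues of $-\tfrac12\Delta$ with Dirichlet conditions on an interval of length $\ell$. Let $\mathcal N_L$ be the measure that puts mass $1/L$ at each eigenvalue $E_s(L_j)$ (with multiplicity), and, for $\mu<\min_jE_1(L_j)$, put $$\rho_L(\beta,\mu)=\frac1L\sum_{j=1}^n\sum_{s=1}^\infty\frac1{e^{\beta(E_s(L_j)-\mu)}-1}.$$ The impurities are random, on a probability space $(\Omega,\mathcal F,\mathbb P)$ (a superscript $\omega$ marks the dependence on $\omega\in\Omega$), in one of the following two ways: 1. they are the points in $(-L/2,L/2)$ of a Poisson point process on $\mathbb R$ of intensity $\lambda$, and the limit is $L\to\infty$ over the reals; 2. for each $n\ge1$ they are $n-1$ independent points, uniformly distributed over $[-L_{(n)}/2,L_{(n)}/2]$, where $L_{(n)}>0$ and $n/L_{(n)}\to\lambda$;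 the joint law for different $n$ is arbitrary, and the limit $L\to\infty$ is the limit of $L=L_{(n)}$ as $n\to\infty$. Define $$n_\lambda(E)=\frac{\lambda^2c}{2}\,\frac{e^{c\lambda/\sqrt E}}{E^{3/2}\,(e^{c\lambda/\sqrt E}-1)^2},\qquad \rho(\beta,\mu)=\int_0^\infty\frac{n_\lambda(E)}{e^{\beta(E-\mu)}-1}\,dE\quad(\mu<0),\qquad \rho_c(\beta)=\lim_{\mu\uparrow0}\rho(\beta,\mu).$$ **Proposition.** The limit $\rho_c(\beta)$ exists and is finite, and in both models the following holds. Almost surely, in each volume the equation $\rho=\rho_L^\omega(\beta,\mu)$ has exactly one solution $\mu=\mu_L^\omega(\beta,\rho)$ below the spectrum, i.e. with $\mu<\min_jE_1(L_j^\omega)$. (a) If $\rho<\rho_c(\beta)$, the equation $\rho=\rho(\beta,\mu)$ has exactly one root $\mu(\beta,\rho)<0$, and almost surely $\lim_{L\to\infty}\mu_L^\omega(\beta,\rho)=\mu(\beta,\rho)$. (b) If $\rho\ge\rho_c(\beta)$, then almost surely $\lim_{L\to\infty}\mu_L^\omega(\beta,\rho)=0$. Moreover, for every $\varepsilon>0$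 the almost sure limit in $$\rho_0(\beta,\rho):=\lim_{\varepsilon\downarrow0}\Big\{\text{a.s.-}\lim_{L\to\infty}\int_{(0,\varepsilon]}\frac{\mathcal N_L^\omega(dE)}{e^{\beta(E-\mu_L^\omega(\beta,\rho))}-1}\Big\}$$ exists and is nonrandom, the limit $\varepsilon\downarrow0$ exists, and the generalized condensate density is $\rho_0(\beta,\rho)=\rho-\rho_c(\beta)$ if $\rho\ge\rho_c(\beta)$ and $\rho_0(\beta,\rho)=0$ if $\rho<\rho_c(\beta)$. -/

import Mathlib

open MeasureTheory ProbabilityTheory Filter Topology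

noncomputable section

namespace LuttingerSy

/-- The nodes in the volume `[-L/2, L/2]`: the impurities inside it and the two walls. -/
def nodes (L : ℝ) (X : Set ℝ) : Set ℝ :=
  (X ∩ Set.Ioo (-(L / 2)) (L / 2)) ∪ {-(L / 2), L / 2}

/-- The intervals between consecutive nodes, each given by its pair of end points. -/
def boxes (L : ℝ) (X : Set ℝ) : Set (ℝ × ℝ) :=
  {p | p.1 ∈ nodes L X ∧ p.2 ∈ nodes L X ∧ p.1 < p.2 ∧
    Disjoint (Set.Ioo p.1 p.2) (nodes L X)}

/-- The `s`-th eigenvalue (`s = 1, 2, …`) of `-Δ/2` with Dirichlet conditions on an interval of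
length `ℓ`. -/
def energy (s : ℕ) (ℓ : ℝ) : ℝ := Real.pi ^ 2 * (s : ℝ) ^ 2 / (2 * ℓ ^ 2)

/-- The eigenvalues (with multiplicity) of the one-particle Hamiltonian in `[-L/2, L/2]`,
the direct sum of the Dirichlet operators of the boxes; the label `(p, k)` stands for the level
`s = k + 1` of the box `p`. -/
def level (L : ℝ) (X : Set ℝ) (q : boxes L X × ℕ) : ℝ :=
  energy (q.2 + 1) (q.1.1.2 - q.1.1.1)

/-- Bose occupation number. -/
def bose (β μ E : ℝ) : ℝ := 1 / (Real.exp (β * (E - μ)) - 1)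

/-- `μ` is an admissible chemical potential (below the whole one-particle spectrum), and the
grand-canonical density in `[-L/2, L/2]` converges and equals `ρ`. -/
def SolvesDensityEq (L : ℝ) (X : Set ℝ) (β ρ μ : ℝ) : Prop :=
  (∀ q, μ < level L X q) ∧ HasSum (fun q => 1 / L * bose β μ (level L X q)) ρ

/-- The finite-volume density-of-states measure: mass `1 / L` at every eigenvalue. -/
def idsMeasure (L : ℝ) (X : Set ℝ) : Measure ℝ :=
  ENNReal.ofReal (1 / L) • Measure.sum (fun q => Measure.dirac (level L X q))

/-- Density of the particles with energy at most `ε`. -/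
def lowEnergyDensity (L : ℝ) (X : Set ℝ) (β μ ε : ℝ) : ℝ :=
  ∫ E in Set.Ioc 0 ε, bose β μ E ∂(idsMeasure L X)

/-- The constant `π / √2`. -/
def cc : ℝ := Real.pi / √2

/-- The limiting density of states, for impurity concentration `lam`. -/
def dos (lam E : ℝ) : ℝ :=
  lam ^ 2 * cc / 2 * Real.exp (cc * lam / √E) /
    (E ^ (3 / 2 : ℝ) * (Real.exp (cc * lam / √E) - 1) ^ 2)

/-- The limiting particle density `ρ(β, μ)`. -/
def rho (lam β μ : ℝ) : ℝ := ∫ E in Set.Ioi 0, dos lam E * bose β μ E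

/-- The critical density. -/
def rhoCrit (lam β : ℝ) : ℝ := limUnder (𝓝[<] (0 : ℝ)) (fun μ => rho lam β μ)

/-- `X` is (the random set of atoms of) a homogeneous Poisson point process on `ℝ` with
intensity `lam`. -/
structure IsPoissonProcess {Ω : Type*} [MeasurableSpace Ω] (P : Measure Ω) (lam : ℝ)
    (X : Ω → Set ℝ) : Prop where
  measurable_count : ∀ B : Set ℝ, MeasurableSet B → Bornology.IsBounded B →
    Measurable (fun ω => (X ω ∩ B).encard)
  law_count : ∀ B : Set ℝ, MeasurableSet B → Bornology.IsBounded B → ∀ m : ℕ,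
    P {ω | (X ω ∩ B).encard = m} =
      ENNReal.ofReal ((lam * volume.real B) ^ m / (m.factorial : ℝ) *
        Real.exp (-(lam * volume.real B)))
  indep_count : ∀ (m : ℕ) (B : Fin m → Set ℝ), (∀ i, MeasurableSet (B i)) →
    (∀ i, Bornology.IsBounded (B i)) → Pairwise (fun i j => Disjoint (B i) (B j)) →
    iIndepFun (fun i ω => (X ω ∩ B i).encard) P

/-- For every `n ≥ 1`, the points `ξ n i` are `n - 1` independent impurities, uniformly
distributed over `[-L n / 2, L n / 2]`, and the concentration `n / L n` tends to `lam`. Nothing is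
assumed on the joint law of the configurations for different `n`. -/
structure IsUniformModel {Ω : Type*} [MeasurableSpace Ω] (P : Measure Ω) (lam : ℝ)
    (L : ℕ → ℝ) (ξ : (n : ℕ) → Fin (n - 1) → Ω → ℝ) : Prop where
  length_pos : ∀ n, 0 < L n
  concentration : Tendsto (fun n : ℕ => (n : ℝ) / L n) atTop (𝓝 lam)
  measurable_point : ∀ n i, Measurable (ξ n i)
  indep_points : ∀ n, iIndepFun (ξ n) P
  uniform_point : ∀ n i, pdf.IsUniform (ξ n i) (Set.Icc (-(L n / 2)) (L n / 2)) P volume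

/-- The asymptotics of the chemical potential and of the condensate at density `ρ`, for a family
of random impurity configurations `X i` in the volumes `[-L i / 2, L i / 2]`, along the filter `l`:
* almost surely the density equation has exactly one solution in each volume;
* if `ρ < ρ_c`, the equation `ρ = ρ(β, μ)` has exactly one negative root, the finite-volume
  solutions converge to it almost surely, and the generalized condensate density is `0`;
* if `ρ ≥ ρ_c`, the finite-volume solutions converge to `0` almost surely, and the generalized
  condensate density is `ρ - ρ_c`.
The function `g` is the (nonrandom) almost sure limit of the density of particles with energy at
most `ε`, in the definition of the generalized condensate density. -/
def CondensationAsymptotics {Ω ι : Type*} [MeasurableSpace Ω] (P : Measure Ω) (l : Filter ι)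
    (L : ι → ℝ) (X : ι → Ω → Set ℝ) (lam β ρ : ℝ) : Prop :=
  (∀ᵐ ω ∂P, ∀ i, 0 < L i → ∃! m : ℝ, SolvesDensityEq (L i) (X i ω) β ρ m) ∧
  ∀ μ : ι → Ω → ℝ,
    (∀ᵐ ω ∂P, ∀ᶠ i in l, SolvesDensityEq (L i) (X i ω) β ρ (μ i ω)) →
    (ρ < rhoCrit lam β →
      (∃ μ₀ : ℝ, μ₀ < 0 ∧ rho lam β μ₀ = ρ ∧ (∀ m < 0, rho lam β m = ρ → m = μ₀) ∧
        ∀ᵐ ω ∂P, Tendsto (fun i => μ i ω) l (𝓝 μ₀)) ∧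
      ∃ g : ℝ → ℝ,
        (∀ ε > 0, ∀ᵐ ω ∂P,
          Tendsto (fun i => lowEnergyDensity (L i) (X i ω) β (μ i ω) ε) l (𝓝 (g ε))) ∧
        Tendsto g (𝓝[>] 0) (𝓝 0)) ∧
    (rhoCrit lam β ≤ ρ →
      (∀ᵐ ω ∂P, Tendsto (fun i => μ i ω) l (𝓝 0)) ∧
      ∃ g : ℝ → ℝ,
        (∀ ε > 0, ∀ᵐ ω ∂P,
          Tendsto (fun i => lowEnergyDensity (L i) (X i ω) β (μ i ω) ε) l (𝓝 (g ε))) ∧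
        Tendsto g (𝓝[>] 0) (𝓝 (ρ - rhoCrit lam β)))

end LuttingerSy

end

/-!
Everything is governed by the *void fractions*: the proportion of points `y` of the volume such that
`(y, y + x)` is a part of it free of impurities. In both models they converge almost surely to
`exp (-λ x)`, for every `x > 0`: for uniform impurities by a bounded-differences concentration
inequality and the Borel–Cantelli lemma, for Poisson impurities by the strong law of large numbers
on disjoint windows. From there on the argument is deterministic.

A box of length `ℓ` contributes `(ℓ - x)₊` to the void fraction, which is convex in `x`; so the
convergence passes to the derivatives (Griffiths' lemma), which count the boxes longer than `x`.
Since `E_s(ℓ) ≤ E` means `s * (π / √(2 E)) ≤ ℓ`, the integrated density of states is a sum of such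
counts, and it converges to the primitive of `n_λ`. The layer-cake formula and dominated convergence
turn this into the convergence of the density of particles above any positive energy. As the
density is monotone in the chemical potential, this locates its limit; what is missing from `ρ`
above every energy `ε` is the condensate.
-/

noncomputable section

namespace LuttingerSy

/-! ### Convergence lemmas -/

lemma tendsto_of_tendsto_of_eventually_le {ι κ : Type*} {l : Filter ι} {m₁ m₂ : Filter κ}
    [NeBot m₁] [NeBot m₂] {f : ι → ℝ} {x : ℝ} {lo hi : κ → ι → ℝ} {lo' hi' : κ → ℝ}
    (hlo : ∀ᶠ k in m₁, Tendsto (lo k) l (𝓝 (lo' k)))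
    (hhi : ∀ᶠ k in m₂, Tendsto (hi k) l (𝓝 (hi' k)))
    (hlof : ∀ᶠ k in m₁, ∀ᶠ i in l, lo k i ≤ f i)
    (hfhi : ∀ᶠ k in m₂, ∀ᶠ i in l, f i ≤ hi k i)
    (hlo' : Tendsto lo' m₁ (𝓝 x)) (hhi' : Tendsto hi' m₂ (𝓝 x)) : Tendsto f l (𝓝 x) := by
  refine tendsto_order.2 ⟨fun a ha => ?_, fun a ha => ?_⟩
  · obtain ⟨k, hk, hle, hlt⟩ :=
      (hlo.and (hlof.and (hlo'.eventually (lt_mem_nhds ha)))).exists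
    filter_upwards [hle, hk.eventually (lt_mem_nhds hlt)] with i h₁ h₂ using h₂.trans_le h₁
  · obtain ⟨k, hk, hle, hlt⟩ :=
      (hhi.and (hfhi.and (hhi'.eventually (gt_mem_nhds ha)))).exists
    filter_upwards [hle, hk.eventually (gt_mem_nhds hlt)] with i h₁ h₂ using h₁.trans_lt h₂

lemma tendsto_of_antitone_of_dense {ι : Type*} {l : Filter ι} {F : ι → ℝ → ℝ} {f : ℝ → ℝ}
    {D : Set ℝ} {x : ℝ} (hD : Dense D) (hF : ∀ᶠ i in l, Antitone (F i))
    (hlim : ∀ᶠ y in 𝓝[D] x, Tendsto (fun i => F i y) l (𝓝 (f y))) (hf : ContinuousAt f x) :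
    Tendsto (fun i => F i x) l (𝓝 (f x)) := by
  have hneBot : ∀ U : Set ℝ, IsOpen U → x ∈ closure U → (𝓝[D ∩ U] x).NeBot := fun U hU hx => by
    rw [← mem_closure_iff_nhdsWithin_neBot, Set.inter_comm]
    exact closure_minimal (hD.open_subset_closure_inter hU) isClosed_closure hx
  have hright := hneBot (Set.Ioi x) isOpen_Ioi (by simp)
  have hleft := hneBot (Set.Iio x) isOpen_Iio (by simp)
  refine tendsto_of_tendsto_of_eventually_le (m₁ := 𝓝[D ∩ Set.Ioi x] x)
    (m₂ := 𝓝[D ∩ Set.Iio x] x) (lo := fun y i => F i y) (hi := fun y i => F i y)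
    (hlim.filter_mono (nhdsWithin_mono _ Set.inter_subset_left))
    (hlim.filter_mono (nhdsWithin_mono _ Set.inter_subset_left)) ?_ ?_
    (hf.tendsto.mono_left nhdsWithin_le_nhds) (hf.tendsto.mono_left nhdsWithin_le_nhds)
  · filter_upwards [self_mem_nhdsWithin] with y hy
    exact hF.mono fun i hi => hi (Set.mem_Ioi.1 hy.2).le
  · filter_upwards [self_mem_nhdsWithin] with y hy
    exact hF.mono fun i hi => hi (Set.mem_Iio.1 hy.2).le

lemma neg_slope_max_sub_le_ite {x y : ℝ} (hxy : x < y) (t : ℝ) :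
    -slope (fun z => max (t - z) 0) x y ≤ if x ≤ t then 1 else 0 := by
  have hpos : 0 < y - x := sub_pos.2 hxy
  rw [slope_def_field, ← neg_div, neg_sub, div_le_iff₀ hpos]
  split_ifs with hx
  · rw [max_eq_left (by linarith)]
    linarith [le_max_left (t - y) 0]
  · rw [max_eq_right (by linarith), max_eq_right (by linarith)]
    simp

lemma ite_le_neg_slope_max_sub {x y : ℝ} (hyx : y < x) (t : ℝ) :
    (if x ≤ t then 1 else 0) ≤ -slope (fun z => max (t - z) 0) x y := by
  have hpos : 0 < x - y := sub_pos.2 hyx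
  rw [slope_comm, slope_def_field, ← neg_div, neg_sub, le_div_iff₀ hpos]
  split_ifs with hx
  · rw [max_eq_left (by linarith), max_eq_left (by linarith)]
    linarith
  · rw [zero_mul, sub_nonneg]
    exact max_le_max_right _ (by linarith)

-- Griffiths' lemma: the convex functions `y ↦ A i (fun t => (t - y)₊)` converge to `V`, hence so do
-- their derivatives where `V` is differentiable.
lemma tendsto_ite_of_tendsto_max_sub {ι : Type*} {l : Filter ι} {A : ι → (ℝ → ℝ) →ₗ[ℝ] ℝ}
    {V : ℝ → ℝ} {V' x : ℝ} (hmono : ∀ᶠ i in l, Monotone (A i))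
    (hA : ∀ᶠ y in 𝓝 x, Tendsto (fun i => A i fun t => max (t - y) 0) l (𝓝 (V y)))
    (hV : HasDerivAt V V' x) :
    Tendsto (fun i => A i fun t => if x ≤ t then 1 else 0) l (𝓝 (-V')) := by
  have hslope : ∀ i y, A i (fun t => -slope (fun z => max (t - z) 0) x y)
      = -slope (fun z => A i fun t => max (t - z) 0) x y := by
    intro i y
    have : (fun t : ℝ => -slope (fun z => max (t - z) 0) x y)
        = -((y - x)⁻¹ • ((fun t => max (t - y) 0) - fun t => max (t - x) 0)) := by
      ext t
      simp [slope]
    rw [this, map_neg, map_smul, map_sub]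
    rfl
  have hlim : ∀ᶠ y in 𝓝 x, Tendsto (fun i => A i fun t => -slope (fun z => max (t - z) 0) x y) l
      (𝓝 (-slope V x y)) := by
    filter_upwards [hA] with y hy
    simp only [hslope]
    simp only [slope_def_field]
    exact ((hy.sub hA.self_of_nhds).div_const _).neg
  have hslopeV : Tendsto (fun y => -slope V x y) (𝓝[≠] x) (𝓝 (-V')) :=
    (hasDerivAt_iff_tendsto_slope.1 hV).neg
  refine tendsto_of_tendsto_of_eventually_le (m₁ := 𝓝[>] x) (m₂ := 𝓝[<] x)
    (lo := fun y i => A i fun t => -slope (fun z => max (t - z) 0) x y)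
    (hi := fun y i => A i fun t => -slope (fun z => max (t - z) 0) x y)
    (hlim.filter_mono nhdsWithin_le_nhds) (hlim.filter_mono nhdsWithin_le_nhds) ?_ ?_
    (hslopeV.mono_left (nhdsGT_le_nhdsNE x)) (hslopeV.mono_left (nhdsLT_le_nhdsNE x))
  · filter_upwards [self_mem_nhdsWithin] with y hy
    exact hmono.mono fun i hi => hi fun t => neg_slope_max_sub_le_ite hy t
  · filter_upwards [self_mem_nhdsWithin] with y hy
    exact hmono.mono fun i hi => hi fun t => ite_le_neg_slope_max_sub hy t

lemma lt_natFloor_div_iff {a : ℝ} (ha : 0 < a) {t : ℝ} {s : ℕ} :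
    s < ⌊t / a⌋₊ ↔ a * (s + 1) ≤ t := by
  rw [← Nat.succ_le_iff, Nat.le_floor_iff' (Nat.succ_ne_zero s), le_div_iff₀ ha, mul_comm,
    Nat.cast_succ]

lemma sum_range_ite_mul_le {a : ℝ} (ha : 0 < a) (t : ℝ) (S : ℕ) :
    ∑ s ∈ Finset.range S, (if a * (s + 1) ≤ t then (1 : ℝ) else 0) = (min S ⌊t / a⌋₊ : ℕ) := by
  simp only [← lt_natFloor_div_iff ha, Finset.sum_boole]
  congr 1
  rw [← Finset.card_range (min S _)]
  congr 1
  ext s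
  simp

lemma natFloor_div_le_sum_ite_add {a : ℝ} (ha : 0 < a) (t : ℝ) (S : ℕ) :
    (⌊t / a⌋₊ : ℝ) ≤ ∑ s ∈ Finset.range S, (if a * (s + 1) ≤ t then (1 : ℝ) else 0)
      + a⁻¹ * max (t - a * S) 0 := by
  rw [sum_range_ite_mul_le ha]
  have hmax : 0 ≤ a⁻¹ * max (t - a * S) 0 := by positivity
  rcases le_total ⌊t / a⌋₊ S with hS | hS
  · rw [min_eq_right hS]
    linarith
  rcases le_total t 0 with ht | ht
  · rw [Nat.floor_of_nonpos (div_nonpos_of_nonpos_of_nonneg ht ha.le)]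
    simpa using hmax
  · rw [min_eq_left hS]
    calc (⌊t / a⌋₊ : ℝ) ≤ t / a := Nat.floor_le (by positivity)
      _ = S + a⁻¹ * (t - a * S) := by field_simp; ring
      _ ≤ S + a⁻¹ * max (t - a * S) 0 := by gcongr; exact le_max_left _ _

lemma tendsto_natFloor_div_of_hasSum {ι : Type*} {l : Filter ι} {A : ι → (ℝ → ℝ) →ₗ[ℝ] ℝ}
    {a q : ℝ} {p v : ℕ → ℝ} (ha : 0 < a) (hmono : ∀ᶠ i in l, Monotone (A i))
    (hp : ∀ s : ℕ, Tendsto (fun i => A i fun t => if a * (s + 1) ≤ t then 1 else 0) l (𝓝 (p s)))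
    (hpq : HasSum p q)
    (hv : ∀ᶠ S : ℕ in atTop, Tendsto (fun i => A i fun t => max (t - a * S) 0) l (𝓝 (v S)))
    (hv0 : Tendsto v atTop (𝓝 0)) :
    Tendsto (fun i => A i fun t => (⌊t / a⌋₊ : ℝ)) l (𝓝 q) := by
  set ind : ℕ → ℝ → ℝ := fun s t => if a * (s + 1) ≤ t then 1 else 0 with hind
  have hsum : ∀ S, Tendsto (fun i => A i (∑ s ∈ Finset.range S, ind s)) l
      (𝓝 (∑ s ∈ Finset.range S, p s)) := fun S => by
    simp only [map_sum]
    exact tendsto_finsetSum _ fun s _ => hp s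
  refine tendsto_of_tendsto_of_eventually_le (m₁ := atTop) (m₂ := atTop)
    (lo := fun S i => A i (∑ s ∈ Finset.range S, ind s))
    (hi := fun S i => A i (∑ s ∈ Finset.range S, ind s + a⁻¹ • fun t => max (t - a * S) 0))
    (hi' := fun S => ∑ s ∈ Finset.range S, p s + a⁻¹ * v S)
    (Eventually.of_forall hsum) ?_ ?_ ?_ hpq.tendsto_sum_nat ?_
  · filter_upwards [hv] with S hS
    simp only [map_add, map_smul, smul_eq_mul]
    exact (hsum S).add (hS.const_mul a⁻¹)
  · refine Eventually.of_forall fun S => hmono.mono fun i hi => hi fun t => ?_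
    simp only [hind, Finset.sum_apply, sum_range_ite_mul_le ha]
    exact_mod_cast min_le_right _ _
  · refine Eventually.of_forall fun S => hmono.mono fun i hi => hi fun t => ?_
    simpa only [hind, Pi.add_apply, Finset.sum_apply, Pi.smul_apply, smul_eq_mul]
      using natFloor_div_le_sum_ite_add ha t S
  · simpa using hpq.tendsto_sum_nat.add (hv0.const_mul a⁻¹)

lemma hasSum_mul_exp_neg {a b : ℝ} (hab : 0 < a * b) :
    HasSum (fun s : ℕ => b * Real.exp (-(b * (a * (s + 1))))) (b / (Real.exp (b * a) - 1)) := by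
  rw [mul_comm] at hab
  have hlt : Real.exp (-(b * a)) < 1 := Real.exp_lt_one_iff.2 (neg_lt_zero.2 hab)
  have hgeom := (hasSum_geometric_of_lt_one (Real.exp_pos _).le hlt).mul_left
    (b * Real.exp (-(b * a)))
  have hterm : ∀ s : ℕ, b * Real.exp (-(b * a)) * Real.exp (-(b * a)) ^ s
      = b * Real.exp (-(b * (a * (s + 1)))) := fun s => by
    rw [mul_assoc, ← Real.exp_nat_mul, ← Real.exp_add]
    ring_nf
  have hsum : b * Real.exp (-(b * a)) * (1 - Real.exp (-(b * a)))⁻¹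
      = b / (Real.exp (b * a) - 1) := by
    have : Real.exp (b * a) - 1 ≠ 0 := (sub_pos.2 (Real.one_lt_exp_iff.2 hab)).ne'
    rw [Real.exp_neg]
    field_simp
  simpa only [hterm, hsum] using hgeom

lemma tendsto_natFloor_div_of_tendsto_exp {ι : Type*} {l : Filter ι} {A : ι → (ℝ → ℝ) →ₗ[ℝ] ℝ}
    {lam a : ℝ} (hlam : 0 < lam) (ha : 0 < a) (hmono : ∀ᶠ i in l, Monotone (A i))
    (hA : ∀ x > 0, Tendsto (fun i => A i fun t => max (t - x) 0) l (𝓝 (Real.exp (-(lam * x))))) :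
    Tendsto (fun i => A i fun t => (⌊t / a⌋₊ : ℝ)) l (𝓝 (lam / (Real.exp (lam * a) - 1))) := by
  refine tendsto_natFloor_div_of_hasSum (v := fun S => Real.exp (-(lam * (a * S)))) ha hmono
    (fun s => ?_) (hasSum_mul_exp_neg (mul_pos ha hlam)) ?_ ?_
  · have hs : 0 < a * ((s : ℝ) + 1) := by positivity
    have hderiv : HasDerivAt (fun x => Real.exp (-(lam * x)))
        (-(lam * Real.exp (-(lam * (a * (s + 1)))))) (a * (s + 1)) := by
      simpa [mul_comm] using ((hasDerivAt_id (a * ((s : ℝ) + 1))).const_mul lam).neg.exp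
    simpa using tendsto_ite_of_tendsto_max_sub hmono
      ((eventually_gt_nhds hs).mono fun y hy => hA y hy) hderiv
  · filter_upwards [eventually_gt_atTop 0] with S hS
    exact hA _ (mul_pos ha (Nat.cast_pos.2 hS))
  · exact Real.tendsto_exp_neg_atTop_nhds_zero.comp
      ((tendsto_natCast_atTop_atTop.const_mul_atTop ha).const_mul_atTop hlam)

/-! ### Almost sure convergence and concentration -/

lemma ae_tendsto_zero_of_forall_tsum_measure_ne_top {Ω : Type*} [MeasurableSpace Ω]
    {P : Measure Ω} {Y : ℕ → Ω → ℝ} (h : ∀ η > 0, ∑' n, P {ω | η ≤ |Y n ω|} ≠ ⊤) :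
    ∀ᵐ ω ∂P, Tendsto (fun n => Y n ω) atTop (𝓝 0) := by
  obtain ⟨η, -, hη, hη0⟩ := exists_seq_strictAnti_tendsto (0 : ℝ)
  have hlt : ∀ᵐ ω ∂P, ∀ k, ∀ᶠ n in atTop, ω ∉ {ω | η k ≤ |Y n ω|} :=
    ae_all_iff.2 fun k => ae_eventually_notMem (h (η k) (hη k))
  filter_upwards [hlt] with ω hω
  refine Metric.tendsto_nhds.2 fun ε hε => ?_
  obtain ⟨k, hk⟩ := (hη0.eventually (gt_mem_nhds hε)).exists
  filter_upwards [hω k] with n hn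
  rw [Real.dist_0_eq_abs]
  exact (not_le.1 hn).trans hk

lemma hasSubgaussianMGF_sub_integral_of_abs_sub_le {α : Type*} [MeasurableSpace α] {μ : Measure α}
    [IsProbabilityMeasure μ] {g : α → ℝ} {c : NNReal} (hg : AEMeasurable g μ)
    (hc : ∀ a b, |g a - g b| ≤ c) :
    HasSubgaussianMGF (fun a => g a - ∫ b, g b ∂μ) ((c / 2) ^ 2) μ := by
  have : Nonempty α := μ.nonempty_of_neZero
  have hbdd : BddBelow (Set.range g) := by
    inhabit α
    refine ⟨g default - c, ?_⟩
    rintro _ ⟨a, rfl⟩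
    linarith [(abs_le.1 (hc a default)).1]
  have hmem : ∀ a, g a ∈ Set.Icc (⨅ b, g b) ((⨅ b, g b) + c) := fun a =>
    ⟨ciInf_le hbdd a, by
      have : g a - c ≤ ⨅ b, g b := le_ciInf fun b => by linarith [(abs_le.1 (hc a b)).2]
      linarith⟩
  simpa using hasSubgaussianMGF_of_mem_Icc hg (Eventually.of_forall hmem)

lemma hasSubgaussianMGF_prod {α β : Type*} [MeasurableSpace α] [MeasurableSpace β]
    {μ : Measure α} {ν : Measure β} [SFinite μ] [SFinite ν] {f : α × β → ℝ} {g : α → ℝ}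
    {c₁ c₂ : NNReal} (hint : ∀ t, Integrable (fun p => Real.exp (t * f p)) (μ.prod ν))
    (hg : HasSubgaussianMGF g c₁ μ)
    (hf : ∀ a, HasSubgaussianMGF (fun b => f (a, b) - g a) c₂ ν) :
    HasSubgaussianMGF f (c₁ + c₂) (μ.prod ν) where
  integrable_exp_mul := hint
  mgf_le t := by
    have hfiber : ∀ a, ∫ b, Real.exp (t * f (a, b)) ∂ν
        ≤ Real.exp (c₂ * t ^ 2 / 2) * Real.exp (t * g a) := fun a => by
      have hsplit : ∀ b, Real.exp (t * f (a, b))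
          = Real.exp (t * (f (a, b) - g a)) * Real.exp (t * g a) := fun b => by
        rw [← Real.exp_add]
        ring_nf
      simp only [hsplit, integral_mul_const]
      gcongr
      exact (hf a).mgf_le t
    calc mgf f (μ.prod ν) t = ∫ a, ∫ b, Real.exp (t * f (a, b)) ∂ν ∂μ := integral_prod _ (hint t)
      _ ≤ ∫ a, Real.exp (c₂ * t ^ 2 / 2) * Real.exp (t * g a) ∂μ :=
          integral_mono_of_nonneg
            (Eventually.of_forall fun a => integral_nonneg fun b => (Real.exp_pos _).le)
            ((hg.integrable_exp_mul t).const_mul _) (Eventually.of_forall hfiber)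
      _ ≤ Real.exp (c₂ * t ^ 2 / 2) * Real.exp (c₁ * t ^ 2 / 2) := by
          rw [integral_const_mul]
          gcongr
          exact hg.mgf_le t
      _ = Real.exp ((c₁ + c₂ : NNReal) * t ^ 2 / 2) := by
          rw [← Real.exp_add]
          push_cast
          ring_nf

/-- A function of finitely many variables whose value changes by at most `c i` when only the `i`-th
variable is changed. -/
def HasBoundedDifferences {ι : Type*} [DecidableEq ι] {α : ι → Type*} (f : (∀ i, α i) → ℝ)
    (c : ι → NNReal) : Prop :=
  ∀ x i a, |f x - f (Function.update x i a)| ≤ c i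

namespace HasBoundedDifferences

variable {n : ℕ} {α : Fin (n + 1) → Type*} {f : (∀ i, α i) → ℝ} {c : Fin (n + 1) → NNReal}

lemma cons_right (hf : HasBoundedDifferences f c) (a : α 0) :
    HasBoundedDifferences (fun x : ∀ i : Fin n, α i.succ => f (Fin.cons a x))
      fun i => c i.succ := fun x i b => by
  simpa only [Fin.cons_update] using hf (Fin.cons a x) i.succ b

lemma abs_cons_sub_cons_le (hf : HasBoundedDifferences f c) (a b : α 0)
    (x : ∀ i : Fin n, α i.succ) : |f (Fin.cons a x) - f (Fin.cons b x)| ≤ c 0 := by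
  simpa only [Fin.update_cons_zero] using hf (Fin.cons a x) 0 b

lemma abs_integral_sub_integral_le [∀ i, MeasurableSpace (α i)] (hf : HasBoundedDifferences f c)
    {π : Measure (∀ i : Fin n, α i.succ)} [IsProbabilityMeasure π]
    (hint : ∀ a, Integrable (fun x => f (Fin.cons a x)) π) (a b : α 0) :
    |∫ x, f (Fin.cons a x) ∂π - ∫ x, f (Fin.cons b x) ∂π| ≤ c 0 := by
  have hle : ∀ x, ‖f (Fin.cons a x) - f (Fin.cons b x)‖ ≤ c 0 := hf.abs_cons_sub_cons_le a b
  rw [← integral_sub (hint a) (hint b)]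
  simpa using norm_integral_le_of_norm_le_const (μ := π) (Eventually.of_forall hle)

end HasBoundedDifferences

lemma measurePreserving_cons {n : ℕ} {α : Fin (n + 1) → Type*} [∀ i, MeasurableSpace (α i)]
    (μ : ∀ i, Measure (α i)) [∀ i, SigmaFinite (μ i)] :
    MeasurePreserving (fun p : α 0 × (∀ i : Fin n, α i.succ) => (Fin.cons p.1 p.2 : ∀ i, α i))
      ((μ 0).prod (Measure.pi fun i : Fin n => μ i.succ)) (Measure.pi μ) := by
  simpa [MeasurableEquiv.piFinSuccAbove] using! (measurePreserving_piFinSuccAbove μ 0).symm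

lemma measurePreserving_uncons {n : ℕ} {α : Fin (n + 1) → Type*} [∀ i, MeasurableSpace (α i)]
    (μ : ∀ i, Measure (α i)) [∀ i, SigmaFinite (μ i)] :
    MeasurePreserving (fun x : ∀ i, α i => (x 0, Fin.tail x)) (Measure.pi μ)
      ((μ 0).prod (Measure.pi fun i : Fin n => μ i.succ)) :=
  measurePreserving_piFinSuccAbove μ 0

lemma integral_pi_eq_integral_integral_cons {n : ℕ} {α : Fin (n + 1) → Type*}
    [∀ i, MeasurableSpace (α i)] {μ : ∀ i, Measure (α i)} [∀ i, SigmaFinite (μ i)]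
    {f : (∀ i, α i) → ℝ} (hf : Integrable f (Measure.pi μ)) :
    ∫ y, f y ∂Measure.pi μ
      = ∫ a, ∫ x, f (Fin.cons a x) ∂(Measure.pi fun i : Fin n => μ i.succ) ∂μ 0 := by
  have hcons := measurePreserving_cons μ
  rw [← hcons.map_eq, integral_map hcons.aemeasurable (by rw [hcons.map_eq]; exact hf.1)]
  exact integral_prod _ (hcons.integrable_comp_of_integrable hf)

lemma hasSubgaussianMGF_of_hasBoundedDifferences {n : ℕ} {α : Fin n → Type*}
    [∀ i, MeasurableSpace (α i)] {μ : ∀ i, Measure (α i)} [∀ i, IsProbabilityMeasure (μ i)]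
    {f : (∀ i, α i) → ℝ} {c : Fin n → NNReal} {B : ℝ} (hf : Measurable f) (hB : ∀ x, |f x| ≤ B)
    (hc : HasBoundedDifferences f c) :
    HasSubgaussianMGF (fun x => f x - ∫ y, f y ∂Measure.pi μ) (∑ i, (c i / 2) ^ 2)
      (Measure.pi μ) := by
  induction n with
  | zero =>
    have hconst : ∀ x, f x - ∫ y, f y ∂Measure.pi μ = 0 := fun x => by
      have : f = fun _ => f x := funext fun y => congrArg f (Subsingleton.elim y x)
      rw [this]
      simp
    simp only [hconst, Finset.univ_eq_empty, Finset.sum_empty]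
    exact HasSubgaussianMGF.fun_zero
  | succ n ih =>
    set π := Measure.pi fun i : Fin n => μ i.succ
    set F : α 0 × (∀ i : Fin n, α i.succ) → ℝ := fun p => f (Fin.cons p.1 p.2) with hF
    set g : α 0 → ℝ := fun a => ∫ x, F (a, x) ∂π
    have hFm : Measurable F := hf.comp (measurePreserving_cons μ).measurable
    have hfiber : ∀ a, Measurable fun x => F (a, x) := fun a => hFm.comp measurable_prodMk_left
    have hgm : Measurable g := (hFm.stronglyMeasurable.integral_prod_right' (ν := π)).measurable
    have hmean : ∫ y, f y ∂Measure.pi μ = ∫ a, g a ∂μ 0 :=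
      integral_pi_eq_integral_integral_cons
        (Integrable.of_bound hf.aestronglyMeasurable B (Eventually.of_forall hB))
    have hprod : HasSubgaussianMGF (fun p => F p - ∫ a, g a ∂μ 0) (∑ i, (c i / 2) ^ 2)
        ((μ 0).prod π) := by
      rw [Fin.sum_univ_succ]
      refine hasSubgaussianMGF_prod (g := fun a => g a - ∫ a, g a ∂μ 0) (fun t => ?_)
        (hasSubgaussianMGF_sub_integral_of_abs_sub_le hgm.aemeasurable
          (hc.abs_integral_sub_integral_le fun a => ?_)) fun a => ?_
      · exact integrable_exp_mul_of_mem_Icc (hFm.sub_const _).aemeasurable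
          (Eventually.of_forall fun p =>
            ⟨sub_le_sub_right (abs_le.1 (hB _)).1 _, sub_le_sub_right (abs_le.1 (hB _)).2 _⟩)
      · exact Integrable.of_bound (hfiber a).aestronglyMeasurable B
          (Eventually.of_forall fun x => hB _)
      · simpa using ih (hfiber a) (fun x => hB _) (hc.cons_right a)
    rw [← (measurePreserving_uncons μ).map_eq] at hprod
    refine (hprod.of_map (measurePreserving_uncons μ).aemeasurable).congr
      (Eventually.of_forall fun x => ?_)
    simp only [hmean, hF, Function.comp_apply, Fin.cons_self_tail]

lemma measureReal_le_abs_le_of_hasSubgaussianMGF {Ω : Type*} [MeasurableSpace Ω] {P : Measure Ω}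
    [IsFiniteMeasure P] {Y : Ω → ℝ} {c : NNReal} {ε : ℝ} (h : HasSubgaussianMGF Y c P)
    (hε : 0 ≤ ε) : P.real {ω | ε ≤ |Y ω|} ≤ 2 * Real.exp (-ε ^ 2 / (2 * c)) := by
  have hunion : {ω | ε ≤ |Y ω|} = {ω | ε ≤ Y ω} ∪ {ω | ε ≤ -Y ω} := by
    ext ω
    simp only [Set.mem_union, Set.mem_ofPred_eq, le_abs]
  calc P.real {ω | ε ≤ |Y ω|} ≤ P.real {ω | ε ≤ Y ω} + P.real {ω | ε ≤ -Y ω} :=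
        hunion ▸ measureReal_union_le _ _
    _ ≤ Real.exp (-ε ^ 2 / (2 * c)) + Real.exp (-ε ^ 2 / (2 * c)) :=
        add_le_add (h.measure_ge_le hε) (h.neg.measure_ge_le hε)
    _ = 2 * Real.exp (-ε ^ 2 / (2 * c)) := (two_mul _).symm

/-! ### The Bose function -/

section Bose

variable {β μ μ' E t : ℝ}

lemma measurable_bose (β μ : ℝ) : Measurable (bose β μ) := by
  unfold bose; fun_prop

lemma exp_mul_sub_sub_one_pos (hβ : 0 < β) (h : μ < t) : 0 < Real.exp (β * (t - μ)) - 1 :=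
  sub_pos.2 (Real.one_lt_exp_iff.2 (mul_pos hβ (sub_pos.2 h)))

lemma bose_pos (hβ : 0 < β) (h : μ < E) : 0 < bose β μ E :=
  one_div_pos.2 (exp_mul_sub_sub_one_pos hβ h)

lemma bose_lt_bose (hβ : 0 < β) (h : μ < μ') (h' : μ' < E) : bose β μ E < bose β μ' E := by
  unfold bose
  refine one_div_lt_one_div_of_lt (exp_mul_sub_sub_one_pos hβ h') ?_
  gcongr

lemma bose_le_bose (hβ : 0 < β) (h : μ ≤ μ') (h' : μ' < E) : bose β μ E ≤ bose β μ' E := by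
  rcases h.eq_or_lt with rfl | h
  exacts [le_rfl, (bose_lt_bose hβ h h').le]

lemma continuousAt_bose (hβ : 0 < β) (h : μ < E) : ContinuousAt (fun m => bose β m E) μ := by
  unfold bose
  exact ContinuousAt.div (by fun_prop) (by fun_prop) (exp_mul_sub_sub_one_pos hβ h).ne'

/-- Minus the derivative of the Bose function in the energy, the density in the layer cake
representation of the Bose function. -/
def negDerivBose (β μ t : ℝ) : ℝ := β * Real.exp (β * (t - μ)) / (Real.exp (β * (t - μ)) - 1) ^ 2

lemma measurable_negDerivBose (β μ : ℝ) : Measurable (negDerivBose β μ) := by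
  unfold negDerivBose; fun_prop

lemma negDerivBose_pos (hβ : 0 < β) (h : μ < t) : 0 < negDerivBose β μ t :=
  div_pos (by positivity) (pow_pos (exp_mul_sub_sub_one_pos hβ h) 2)

lemma continuousAt_negDerivBose (hβ : 0 < β) (h : μ < t) :
    ContinuousAt (fun m => negDerivBose β m t) μ := by
  unfold negDerivBose
  exact ContinuousAt.div (by fun_prop) (by fun_prop)
    (pow_ne_zero 2 (exp_mul_sub_sub_one_pos hβ h).ne')

lemma hasDerivAt_bose (hβ : 0 < β) (h : μ < t) :
    HasDerivAt (bose β μ) (-negDerivBose β μ t) t := by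
  have hd := ((((hasDerivAt_id t).sub_const μ).const_mul β).exp.sub_const 1).fun_inv
    (exp_mul_sub_sub_one_pos hβ h).ne'
  refine (hd.congr_deriv ?_).congr_of_eventuallyEq (Eventually.of_forall fun x => ?_)
  · simp only [negDerivBose, id]; ring
  · simp only [bose, id, one_div]

lemma tendsto_bose_atTop (hβ : 0 < β) (μ : ℝ) : Tendsto (bose β μ) atTop (𝓝 0) := by
  refine Tendsto.div_atTop tendsto_const_nhds
    (tendsto_atTop_add_const_right _ (-1) (Real.tendsto_exp_atTop.comp ?_))
  exact (tendsto_atTop_add_const_right _ (-μ) tendsto_id).const_mul_atTop hβ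

lemma ofReal_bose_eq_lintegral (hβ : 0 < β) (h : μ < E) :
    ENNReal.ofReal (bose β μ E) = ∫⁻ t in Set.Ioi E, ENNReal.ofReal (negDerivBose β μ t) := by
  have hcont : ContinuousWithinAt (bose β μ) (Set.Ici E) E :=
    (hasDerivAt_bose hβ h).continuousAt.continuousWithinAt
  have hderiv : ∀ x ∈ Set.Ioi E, HasDerivAt (bose β μ) (-negDerivBose β μ x) x := fun x hx =>
    hasDerivAt_bose hβ (h.trans hx)
  have hpos : ∀ x ∈ Set.Ioi E, 0 < negDerivBose β μ x := fun x hx =>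
    negDerivBose_pos hβ (h.trans hx)
  have hneg : ∀ x ∈ Set.Ioi E, -negDerivBose β μ x ≤ 0 := fun x hx => neg_nonpos.2 (hpos x hx).le
  have hint : IntegrableOn (negDerivBose β μ) (Set.Ioi E) := by
    simpa only [Pi.neg_def, neg_neg] using
      (integrableOn_Ioi_deriv_of_nonpos hcont hderiv hneg (tendsto_bose_atTop hβ μ)).neg
  have hval := integral_Ioi_of_hasDerivAt_of_nonpos hcont hderiv hneg (tendsto_bose_atTop hβ μ)
  rw [integral_neg, zero_sub, neg_inj] at hval
  rw [← hval, ofReal_integral_eq_lintegral_ofReal hint]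
  filter_upwards [ae_restrict_mem measurableSet_Ioi] with x hx using (hpos x hx).le

lemma lintegral_bose_eq_lintegral_measure_Ioc {ε : ℝ} (hβ : 0 < β) (h : μ ≤ ε) (m : Measure ℝ)
    [SFinite m] :
    ∫⁻ E in Set.Ioi ε, ENNReal.ofReal (bose β μ E) ∂m
      = ∫⁻ t in Set.Ioi ε, ENNReal.ofReal (negDerivBose β μ t) * m (Set.Ioc ε t) := by
  set w : ℝ → ENNReal := fun t => ENNReal.ofReal (negDerivBose β μ t)
  have hw : Measurable w := (measurable_negDerivBose β μ).ennreal_ofReal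
  calc ∫⁻ E in Set.Ioi ε, ENNReal.ofReal (bose β μ E) ∂m
      = ∫⁻ E in Set.Ioi ε, (∫⁻ t in Set.Ioi ε, (Set.Ici E).indicator w t) ∂m := by
        refine setLIntegral_congr_fun measurableSet_Ioi fun E hE => ?_
        have hsub : Set.Ici E ⊆ Set.Ioi ε := fun t ht => (Set.mem_Ioi.1 hE).trans_le ht
        rw [ofReal_bose_eq_lintegral hβ (h.trans_lt hE), setLIntegral_congr Ioi_ae_eq_Ici,
          setLIntegral_indicator measurableSet_Ici, Set.inter_eq_left.2 hsub]
    _ = ∫⁻ t in Set.Ioi ε, (∫⁻ E in Set.Ioi ε, (Set.Iic t).indicator (fun _ => w t) E ∂m) := by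
        refine lintegral_lintegral_swap (Measurable.aemeasurable ?_)
        exact Measurable.ite (measurableSet_le measurable_fst measurable_snd)
          (hw.comp measurable_snd) measurable_const
    _ = ∫⁻ t in Set.Ioi ε, w t * m (Set.Ioc ε t) := by
        refine lintegral_congr fun t => ?_
        rw [lintegral_indicator_const measurableSet_Iic, Measure.restrict_apply measurableSet_Iic,
          Set.inter_comm, Set.Ioi_inter_Iic]

lemma negDerivBose_eq_exp_neg (hβ : 0 < β) (h : μ < t) : negDerivBose β μ t
    = β * Real.exp (-(β * (t - μ))) / (1 - Real.exp (-(β * (t - μ)))) ^ 2 := by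
  have hpos := exp_mul_sub_sub_one_pos hβ h
  have hne : 1 - (Real.exp (β * (t - μ)))⁻¹ ≠ 0 := by
    rw [sub_ne_zero, ne_comm, inv_ne_one]; linarith
  rw [negDerivBose, Real.exp_neg]
  field_simp

lemma negDerivBose_le_mul_exp_neg {ν ε : ℝ} (hβ : 0 < β) (hμ : μ ≤ ν) (hν : ν < ε) (ht : ε < t) :
    negDerivBose β μ t
      ≤ β * Real.exp (β * ν) / (1 - Real.exp (-(β * (ε - ν)))) ^ 2 * Real.exp (-(β * t)) := by
  have hgap : 0 < 1 - Real.exp (-(β * (ε - ν))) :=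
    sub_pos.2 (Real.exp_lt_one_iff.2 (by nlinarith))
  calc negDerivBose β μ t
      = β * Real.exp (-(β * (t - μ))) / (1 - Real.exp (-(β * (t - μ)))) ^ 2 :=
        negDerivBose_eq_exp_neg hβ (hμ.trans_lt (hν.trans ht))
    _ ≤ β * Real.exp (β * ν + -(β * t)) / (1 - Real.exp (-(β * (ε - ν)))) ^ 2 := by
        gcongr ?_ * Real.exp ?_ / (1 - Real.exp (-(_ * ?_))) ^ 2 <;> nlinarith
    _ = _ := by rw [Real.exp_add]; ring

lemma integrableOn_sqrt_mul_exp_neg_mul (hβ : 0 < β) :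
    IntegrableOn (fun t => √t * Real.exp (-(β * t))) (Set.Ioi 0) := by
  simpa only [Real.sqrt_eq_rpow, Real.rpow_one, neg_mul] using
    integrableOn_rpow_mul_exp_neg_mul_rpow (p := 1) (s := 1 / 2) (by norm_num) one_pos hβ

/-- Dominated convergence in the layer cake representation. -/
lemma tendsto_lintegral_bose_of_tendsto_measure_Ioc {ι : Type*} {l : Filter ι}
    [l.IsCountablyGenerated] {m : ι → Measure ℝ} [∀ i, SFinite (m i)] {m₀ : Measure ℝ} [SFinite m₀]
    {ν : ι → ℝ} {ν₀ ε C : ℝ} (hβ : 0 < β) (hε : 0 ≤ ε) (hν : Tendsto ν l (𝓝 ν₀)) (hν₀ : ν₀ < ε)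
    (hbound : ∀ᶠ i in l, ∀ t > ε, m i (Set.Ioc ε t) ≤ ENNReal.ofReal (C * √t))
    (hlim : ∀ t > ε, Tendsto (fun i => m i (Set.Ioc ε t)) l (𝓝 (m₀ (Set.Ioc ε t)))) :
    Tendsto (fun i => ∫⁻ E in Set.Ioi ε, ENNReal.ofReal (bose β (ν i) E) ∂m i) l
      (𝓝 (∫⁻ E in Set.Ioi ε, ENNReal.ofReal (bose β ν₀ E) ∂m₀)) := by
  obtain ⟨κ, hν₀κ, hκε⟩ := exists_between hν₀
  have hνκ : ∀ᶠ i in l, ν i ≤ κ := (hν.eventually_lt_const hν₀κ).mono fun _ => le_of_lt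
  set A := β * Real.exp (β * κ) / (1 - Real.exp (-(β * (ε - κ)))) ^ 2
  rw [lintegral_bose_eq_lintegral_measure_Ioc hβ hν₀.le m₀]
  refine Tendsto.congr' (hνκ.mono fun i hi =>
    (lintegral_bose_eq_lintegral_measure_Ioc hβ (hi.trans hκε.le) (m i)).symm) ?_
  refine tendsto_lintegral_filter_of_dominated_convergence
    (fun t => ENNReal.ofReal (A * C * (√t * Real.exp (-(β * t))))) ?_ ?_ ?_ ?_
  · exact Eventually.of_forall fun i => (measurable_negDerivBose β _).ennreal_ofReal.mul
      (Monotone.measurable fun s t hst => measure_mono (Set.Ioc_subset_Ioc_right hst))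
  · filter_upwards [hνκ, hbound] with i hi hm
    filter_upwards [ae_restrict_mem measurableSet_Ioi] with t ht
    calc ENNReal.ofReal (negDerivBose β (ν i) t) * m i (Set.Ioc ε t)
        ≤ ENNReal.ofReal (A * Real.exp (-(β * t))) * ENNReal.ofReal (C * √t) := by
          gcongr
          exacts [negDerivBose_le_mul_exp_neg hβ hi hκε ht, hm t ht]
      _ = _ := by
          rw [← ENNReal.ofReal_mul (by positivity)]
          congr 1; ring
  · exact (((integrableOn_sqrt_mul_exp_neg_mul hβ).mono_set
      (Set.Ioi_subset_Ioi hε)).const_mul (A * C)).lintegral_lt_top.ne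
  · filter_upwards [ae_restrict_mem measurableSet_Ioi] with t ht
    have hν₀t : ν₀ < t := hν₀.trans ht
    refine ENNReal.Tendsto.mul (ENNReal.tendsto_ofReal
        ((continuousAt_negDerivBose hβ hν₀t).tendsto.comp hν))
      (Or.inl (ENNReal.ofReal_pos.2 (negDerivBose_pos hβ hν₀t)).ne') (hlim t ht)
      (Or.inr ENNReal.ofReal_ne_top)

end Bose

/-! ### Geometry of the boxes -/

section Geometry

variable {L x y : ℝ} {X : Set ℝ}

/-- The left end points of the intervals of length `x` inside the volume that are free of
impurities. -/
def voidSet (L : ℝ) (X : Set ℝ) (x : ℝ) : Set ℝ :=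
  {y | -(L / 2) ≤ y ∧ y + x ≤ L / 2 ∧ Disjoint (Set.Ioo y (y + x)) X}

/-- The fraction of the volume covered by `voidSet`. -/
def voidFraction (L : ℝ) (X : Set ℝ) (x : ℝ) : ℝ := 1 / L * volume.real (voidSet L X x)

lemma voidSet_antitone (L : ℝ) (X : Set ℝ) : Antitone (voidSet L X) := fun _ _ h _ hz =>
  ⟨hz.1, by linarith [hz.2.1], hz.2.2.mono_left (Set.Ioo_subset_Ioo_right (by linarith))⟩

lemma voidSet_subset_Icc (L : ℝ) (X : Set ℝ) (x : ℝ) :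
    voidSet L X x ⊆ Set.Icc (-(L / 2)) (L / 2 - x) :=
  fun _ hz => ⟨hz.1, by linarith [hz.2.1]⟩

lemma volume_voidSet_ne_top (L : ℝ) (X : Set ℝ) (x : ℝ) : volume (voidSet L X x) ≠ ⊤ :=
  measure_ne_top_of_subset (voidSet_subset_Icc L X x) measure_Icc_lt_top.ne

lemma voidFraction_antitone (hL : 0 < L) (X : Set ℝ) : Antitone (voidFraction L X) := fun x y h =>
  mul_le_mul_of_nonneg_left
    (measureReal_mono (voidSet_antitone L X h) (volume_voidSet_ne_top L X x)) (by positivity)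

lemma nodes_finite (hX : (X ∩ Set.Ioo (-(L / 2)) (L / 2)).Finite) : (nodes L X).Finite :=
  hX.union (Set.toFinite _)

lemma boxes_finite (hX : (X ∩ Set.Ioo (-(L / 2)) (L / 2)).Finite) : (boxes L X).Finite :=
  ((nodes_finite hX).prod (nodes_finite hX)).subset fun _ hp => ⟨hp.1, hp.2.1⟩

lemma left_mem_nodes (L : ℝ) (X : Set ℝ) : -(L / 2) ∈ nodes L X := Or.inr (Or.inl rfl)

lemma right_mem_nodes (L : ℝ) (X : Set ℝ) : L / 2 ∈ nodes L X := Or.inr (Or.inr rfl)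

lemma nodes_subset_Icc (hL : 0 < L) (X : Set ℝ) : nodes L X ⊆ Set.Icc (-(L / 2)) (L / 2) := by
  rintro z (⟨-, h⟩ | rfl | rfl)
  · exact Set.Ioo_subset_Icc_self h
  all_goals constructor <;> linarith

lemma exists_box_of_disjoint_nodes (hX : (X ∩ Set.Ioo (-(L / 2)) (L / 2)).Finite) {u v : ℝ}
    (hu : -(L / 2) ≤ u) (huv : u < v) (hv : v ≤ L / 2) (hd : Disjoint (Set.Ioo u v) (nodes L X)) :
    ∃ p ∈ boxes L X, p.1 ≤ u ∧ v ≤ p.2 := by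
  obtain ⟨a, ⟨ha, hau⟩, hmax⟩ := Set.exists_max_image {z | z ∈ nodes L X ∧ z ≤ u} id
    ((nodes_finite hX).subset fun _ hz => hz.1) ⟨_, left_mem_nodes L X, hu⟩
  obtain ⟨b, ⟨hb, hvb⟩, hmin⟩ := Set.exists_min_image {z | z ∈ nodes L X ∧ v ≤ z} id
    ((nodes_finite hX).subset fun _ hz => hz.1) ⟨_, right_mem_nodes L X, hv⟩
  refine ⟨(a, b), ⟨ha, hb, hau.trans_lt (huv.trans_le hvb), ?_⟩, hau, hvb⟩
  rw [Set.disjoint_left]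
  rintro z ⟨haz, hzb⟩ hz
  have huz : u < z := not_le.1 fun h => haz.not_ge (hmax z ⟨hz, h⟩)
  have hzv : z < v := not_le.1 fun h => hzb.not_ge (hmin z ⟨hz, h⟩)
  exact Set.disjoint_left.1 hd ⟨huz, hzv⟩ hz

lemma boxes_nonempty (hL : 0 < L) (hX : (X ∩ Set.Ioo (-(L / 2)) (L / 2)).Finite) :
    (boxes L X).Nonempty := by
  obtain ⟨b, ⟨hb, hvb⟩, hmin⟩ := Set.exists_min_image {z | z ∈ nodes L X ∧ -(L / 2) < z} id
    ((nodes_finite hX).subset fun _ hz => hz.1) ⟨_, right_mem_nodes L X, by linarith⟩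
  exact ⟨(-(L / 2), b), left_mem_nodes L X, hb, hvb,
    Set.disjoint_left.2 fun z hz hzX => hz.2.not_ge (hmin z ⟨hzX, hz.1⟩)⟩

lemma eq_of_mem_boxes_of_lt_of_lt {p q : ℝ × ℝ} (hp : p ∈ boxes L X) (hq : q ∈ boxes L X)
    (hpq : p.1 < q.2) (hqp : q.1 < p.2) : p = q := by
  obtain ⟨hp1, hp2, -, hpd⟩ := hp
  obtain ⟨hq1, hq2, -, hqd⟩ := hq
  rw [Set.disjoint_left] at hpd hqd
  refine Prod.ext (le_antisymm ?_ ?_) (le_antisymm ?_ ?_) <;> refine not_lt.1 fun h => ?_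
  exacts [hqd ⟨h, hpq⟩ hp1, hpd ⟨h, hqp⟩ hq1, hpd ⟨hpq, h⟩ hq2, hqd ⟨hqp, h⟩ hp2]

lemma voidSet_eq_iUnion (hL : 0 < L) (hX : (X ∩ Set.Ioo (-(L / 2)) (L / 2)).Finite) (hx : 0 < x) :
    voidSet L X x = ⋃ p : boxes L X, Set.Icc p.1.1 (p.1.2 - x) := by
  ext y
  simp only [Set.mem_iUnion]
  constructor
  · rintro ⟨hy, hyx, hdisj⟩
    have hnodes : Disjoint (Set.Ioo y (y + x)) (nodes L X) := by
      rw [Set.disjoint_left] at hdisj ⊢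
      rintro z hz (hzX | rfl | rfl)
      exacts [hdisj hz hzX.1, hz.1.not_ge hy, hz.2.not_ge hyx]
    obtain ⟨p, hp, hpy, hyp⟩ := exists_box_of_disjoint_nodes hX hy (by linarith) hyx hnodes
    exact ⟨⟨p, hp⟩, hpy, le_sub_iff_add_le.2 hyp⟩
  · rintro ⟨⟨p, hp1, hp2, _, hdisj⟩, hpy, hyp⟩
    have hleft := (nodes_subset_Icc hL X hp1).1
    have hright := (nodes_subset_Icc hL X hp2).2
    have hyp' : y + x ≤ p.2 := le_sub_iff_add_le.1 hyp
    refine ⟨hleft.trans hpy, hyp'.trans hright, Set.disjoint_left.2 fun z hz hzX => ?_⟩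
    have hzp : z ∈ Set.Ioo p.1 p.2 := ⟨hpy.trans_lt hz.1, hz.2.trans_le hyp'⟩
    exact Set.disjoint_left.1 hdisj hzp
      (Or.inl ⟨hzX, hleft.trans_lt hzp.1, hzp.2.trans_le hright⟩)

/-- The spatial average, over the volume, of a function of the box lengths. -/
def boxAvg (L : ℝ) (X : Set ℝ) [Finite (boxes L X)] : (ℝ → ℝ) →ₗ[ℝ] ℝ where
  toFun f := 1 / L * ∑' p : boxes L X, f (p.1.2 - p.1.1)
  map_add' f g := by
    simp only [Pi.add_apply, ← mul_add]
    rw [Summable.tsum_add .of_finite .of_finite]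
  map_smul' c f := by
    simp only [Pi.smul_apply, smul_eq_mul, tsum_mul_left, RingHom.id_apply, mul_left_comm]

variable [Finite (boxes L X)]

lemma boxAvg_apply (f : ℝ → ℝ) : boxAvg L X f = 1 / L * ∑' p : boxes L X, f (p.1.2 - p.1.1) := rfl

lemma boxAvg_monotone (hL : 0 < L) (X : Set ℝ) [Finite (boxes L X)] : Monotone (boxAvg L X) :=
  fun f g h => mul_le_mul_of_nonneg_left
    (Summable.tsum_le_tsum (fun _ => h _) .of_finite .of_finite) (by positivity)

lemma voidFraction_eq_boxAvg (hL : 0 < L) (hX : (X ∩ Set.Ioo (-(L / 2)) (L / 2)).Finite)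
    (hx : 0 < x) : voidFraction L X x = boxAvg L X fun ℓ => max (ℓ - x) 0 := by
  have hdisj : Pairwise fun p q : boxes L X =>
      Disjoint (Set.Icc p.1.1 (p.1.2 - x)) (Set.Icc q.1.1 (q.1.2 - x)) := fun p q hpq =>
    Set.disjoint_left.2 fun y hy hy' => hpq <| Subtype.ext <|
      eq_of_mem_boxes_of_lt_of_lt p.2 q.2 (by linarith [hy.1, hy'.2]) (by linarith [hy.2, hy'.1])
  rw [voidFraction, boxAvg_apply, voidSet_eq_iUnion hL hX hx, measureReal_def,
    measure_iUnion hdisj fun _ => measurableSet_Icc,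
    ENNReal.tsum_toReal_eq fun _ => measure_Icc_lt_top.ne]
  congr! 3 with p
  rw [Real.volume_Icc, ENNReal.toReal_ofReal', sub_right_comm]

lemma boxAvg_max_zero_le_one (hL : 0 < L) (X : Set ℝ) [Finite (boxes L X)] :
    boxAvg L X (fun ℓ => max ℓ 0) ≤ 1 := by
  have hdisj : Pairwise fun p q : boxes L X =>
      Disjoint (Set.Ico p.1.1 p.1.2) (Set.Ico q.1.1 q.1.2) := fun p q hpq =>
    Set.disjoint_left.2 fun y hy hy' => hpq <| Subtype.ext <|
      eq_of_mem_boxes_of_lt_of_lt p.2 q.2 (hy.1.trans_lt hy'.2) (hy'.1.trans_lt hy.2)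
  have hsub : ⋃ p : boxes L X, Set.Ico p.1.1 p.1.2 ⊆ Set.Icc (-(L / 2)) (L / 2) :=
    Set.iUnion_subset fun p y hy => ⟨(nodes_subset_Icc hL X p.2.1).1.trans hy.1,
      hy.2.le.trans (nodes_subset_Icc hL X p.2.2.1).2⟩
  have hsum : ∑' p : boxes L X, max (p.1.2 - p.1.1) 0 ≤ L := by
    calc ∑' p : boxes L X, max (p.1.2 - p.1.1) 0
        = volume.real (⋃ p : boxes L X, Set.Ico p.1.1 p.1.2) := by
          rw [measureReal_def, measure_iUnion hdisj fun _ => measurableSet_Ico,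
            ENNReal.tsum_toReal_eq fun _ => measure_Ico_lt_top.ne]
          simp only [Real.volume_Ico, ENNReal.toReal_ofReal']
      _ ≤ volume.real (Set.Icc (-(L / 2)) (L / 2)) :=
          measureReal_mono hsub measure_Icc_lt_top.ne
      _ = L := by rw [Real.volume_real_Icc, max_eq_left] <;> linarith
  rw [boxAvg_apply, one_div, inv_mul_le_iff₀ hL, mul_one]
  exact hsum

end Geometry

/-! ### The counting function of the eigenvalues -/

section Counting

variable {L t : ℝ} {X : Set ℝ}

lemma cc_pos : 0 < cc := by unfold cc; positivity

lemma energy_eq_sq (s : ℕ) (ℓ : ℝ) : energy s ℓ = (cc * s / ℓ) ^ 2 := by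
  unfold energy cc
  rw [div_pow, mul_pow, div_pow, Real.sq_sqrt zero_le_two]
  ring

lemma energy_pos {s : ℕ} {ℓ : ℝ} (hs : s ≠ 0) (hℓ : 0 < ℓ) : 0 < energy s ℓ := by
  unfold energy; positivity

lemma energy_le_iff {s : ℕ} {ℓ : ℝ} (hℓ : 0 < ℓ) (ht : 0 < t) :
    energy s ℓ ≤ t ↔ (s : ℝ) ≤ ℓ / (cc / √t) := by
  have hc := cc_pos
  rw [energy_eq_sq, ← Real.le_sqrt (by positivity) ht.le, div_le_iff₀ hℓ, div_div_eq_mul_div,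
    le_div_iff₀ hc, mul_comm cc, mul_comm ℓ]

lemma length_pos_of_box (p : boxes L X) : 0 < p.1.2 - p.1.1 := sub_pos.2 p.2.2.2.1

lemma level_pos (q : boxes L X × ℕ) : 0 < level L X q :=
  energy_pos q.2.succ_ne_zero (length_pos_of_box q.1)

lemma level_le_iff (p : boxes L X) (k : ℕ) (ht : 0 < t) :
    level L X (p, k) ≤ t ↔ k < ⌊(p.1.2 - p.1.1) / (cc / √t)⌋₊ := by
  rw [level, energy_le_iff (length_pos_of_box p) ht, ← Nat.le_floor_iff' k.succ_ne_zero,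
    Nat.succ_le_iff]

lemma lintegral_idsMeasure (L : ℝ) (X : Set ℝ) {f : ℝ → ENNReal} (hf : Measurable f) :
    ∫⁻ E, f E ∂(idsMeasure L X)
      = ENNReal.ofReal (1 / L) * ∑' q : boxes L X × ℕ, f (level L X q) := by
  simp only [idsMeasure, lintegral_smul_measure, lintegral_sum_measure, lintegral_dirac' _ hf,
    smul_eq_mul]

lemma idsMeasure_apply {s : Set ℝ} (hs : MeasurableSet s) : idsMeasure L X s
    = ENNReal.ofReal (1 / L) * ∑' q : boxes L X × ℕ, s.indicator 1 (level L X q) := by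
  rw [← lintegral_indicator_one hs, lintegral_idsMeasure L X (measurable_one.indicator hs)]

instance [Finite (boxes L X)] : SFinite (idsMeasure L X) := by
  unfold idsMeasure; infer_instance

lemma idsMeasure_Iic_zero (L : ℝ) (X : Set ℝ) : idsMeasure L X (Set.Iic 0) = 0 := by
  simp only [idsMeasure_apply measurableSet_Iic, Set.indicator, Set.mem_Iic, (level_pos _).not_ge,
    if_false, tsum_zero, mul_zero]

lemma tsum_indicator_Iic_level (p : boxes L X) (ht : 0 < t) :
    ∑' k : ℕ, (Set.Iic t).indicator (1 : ℝ → ENNReal) (level L X (p, k))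
      = ENNReal.ofReal ⌊(p.1.2 - p.1.1) / (cc / √t)⌋₊ := by
  simp only [Set.indicator_apply, Set.mem_Iic, level_le_iff p _ ht, Pi.one_apply]
  rw [tsum_eq_sum (s := Finset.range ⌊(p.1.2 - p.1.1) / (cc / √t)⌋₊) fun k hk =>
      if_neg (Finset.mem_range.not.1 hk),
    Finset.sum_congr rfl fun k hk => if_pos (Finset.mem_range.1 hk)]
  simp

lemma idsMeasure_Iic (hL : 0 < L) (X : Set ℝ) [Finite (boxes L X)] (ht : 0 < t) :
    idsMeasure L X (Set.Iic t)
      = ENNReal.ofReal (boxAvg L X fun ℓ => (⌊ℓ / (cc / √t)⌋₊ : ℝ)) := by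
  rw [idsMeasure_apply measurableSet_Iic, ENNReal.tsum_prod', boxAvg_apply,
    ENNReal.ofReal_mul (by positivity),
    ENNReal.ofReal_tsum_of_nonneg (fun _ => Nat.cast_nonneg _) .of_finite]
  simp only [tsum_indicator_Iic_level _ ht]

lemma idsMeasure_Iic_le (hL : 0 < L) (X : Set ℝ) [Finite (boxes L X)] (ht : 0 < t) :
    idsMeasure L X (Set.Iic t) ≤ ENNReal.ofReal (√t / cc) := by
  have hc := cc_pos
  have hfloor : (fun ℓ : ℝ => (⌊ℓ / (cc / √t)⌋₊ : ℝ)) ≤ (√t / cc) • fun ℓ => max ℓ 0 := by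
    intro ℓ
    calc (⌊ℓ / (cc / √t)⌋₊ : ℝ) ≤ ⌊max ℓ 0 / (cc / √t)⌋₊ := by gcongr; exact le_max_left ℓ 0
      _ ≤ max ℓ 0 / (cc / √t) := Nat.floor_le (by positivity)
      _ = √t / cc * max ℓ 0 := by rw [div_div_eq_mul_div]; ring
  rw [idsMeasure_Iic hL X ht]
  refine ENNReal.ofReal_le_ofReal ((boxAvg_monotone hL X hfloor).trans ?_)
  rw [map_smul, smul_eq_mul]
  exact mul_le_of_le_one_right (by positivity) (boxAvg_max_zero_le_one hL X)

end Counting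

/-! ### The limiting density of states -/

section DensityOfStates

variable {lam β μ E ε t : ℝ}

/-- The limiting integrated density of states, the primitive of `dos lam` vanishing at `0`. The
value at `E = 0` is correct only because `cc * lam / √0 = 0` and `lam / 0 = 0`. -/
def ids (lam E : ℝ) : ℝ := lam / (Real.exp (cc * lam / √E) - 1)

/-- The limiting density-of-states measure. -/
def dosMeasure (lam : ℝ) : Measure ℝ := volume.withDensity fun E => ENNReal.ofReal (dos lam E)

lemma measurable_dos (lam : ℝ) : Measurable (dos lam) := by
  unfold dos; fun_prop

instance : SFinite (dosMeasure lam) := by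
  unfold dosMeasure; infer_instance

lemma exp_div_sqrt_sub_one_pos (hlam : 0 < lam) (hE : 0 < E) :
    0 < Real.exp (cc * lam / √E) - 1 :=
  sub_pos.2 (Real.one_lt_exp_iff.2 (div_pos (mul_pos cc_pos hlam) (Real.sqrt_pos.2 hE)))

lemma rpow_three_halves (hE : 0 ≤ E) : E ^ (3 / 2 : ℝ) = √E ^ 3 := by
  rw [Real.sqrt_eq_rpow, ← Real.rpow_mul_natCast hE]; norm_num

lemma dos_pos (hlam : 0 < lam) (hE : 0 < E) : 0 < dos lam E := by
  have hexp := exp_div_sqrt_sub_one_pos hlam hE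
  have hc := cc_pos
  unfold dos
  positivity

lemma ids_zero (lam : ℝ) : ids lam 0 = 0 := by simp [ids]

lemma ids_pos (hlam : 0 < lam) (hE : 0 < E) : 0 < ids lam E :=
  div_pos hlam (exp_div_sqrt_sub_one_pos hlam hE)

lemma hasDerivAt_ids (hlam : 0 < lam) (hE : 0 < E) : HasDerivAt (ids lam) (dos lam E) E := by
  have hsqrt := Real.sqrt_pos.2 hE
  have hne := (exp_div_sqrt_sub_one_pos hlam hE).ne'
  have hd := ((((Real.hasDerivAt_sqrt hE.ne').fun_inv hsqrt.ne').const_mul (cc * lam)).exp.sub_const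
    1).fun_inv (by rwa [← div_eq_mul_inv]) |>.const_mul lam
  refine (hd.congr_deriv ?_).congr_of_eventuallyEq (Eventually.of_forall fun x => ?_)
  · rw [dos, rpow_three_halves hE.le, ← div_eq_mul_inv]
    field_simp
  · simp only [ids, div_eq_mul_inv]

lemma tendsto_ids_zero (hlam : 0 < lam) : Tendsto (ids lam) (𝓝[>] 0) (𝓝 0) := by
  have hsqrt : Tendsto (fun E : ℝ => √E) (𝓝[>] 0) (𝓝[>] 0) :=
    tendsto_nhdsWithin_iff.2 ⟨tendsto_nhdsWithin_of_tendsto_nhds (by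
      simpa only [Real.sqrt_zero] using Real.continuous_sqrt.tendsto 0),
      eventually_nhdsWithin_of_forall fun _ => Real.sqrt_pos.2⟩
  have hexponent : Tendsto (fun E : ℝ => cc * lam / √E) (𝓝[>] 0) atTop := by
    simp only [div_eq_mul_inv]
    exact (tendsto_inv_nhdsGT_zero.comp hsqrt).const_mul_atTop (mul_pos cc_pos hlam)
  exact Tendsto.div_atTop tendsto_const_nhds
    (tendsto_atTop_add_const_right _ (-1) (Real.tendsto_exp_atTop.comp hexponent))

lemma continuousOn_ids (hlam : 0 < lam) : ContinuousOn (ids lam) (Set.Ici 0) := by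
  intro E hE
  rcases (Set.mem_Ici.1 hE).eq_or_lt with rfl | hE
  · rw [← continuousWithinAt_Ioi_iff_Ici, ContinuousWithinAt, ids_zero]
    exact tendsto_ids_zero hlam
  · exact (hasDerivAt_ids hlam hE).continuousAt.continuousWithinAt

lemma dosMeasure_Ioc (hlam : 0 < lam) (hε : 0 ≤ ε) (ht : ε ≤ t) :
    dosMeasure lam (Set.Ioc ε t) = ENNReal.ofReal (ids lam t - ids lam ε) := by
  have hcont : ContinuousOn (ids lam) (Set.Icc ε t) :=
    (continuousOn_ids hlam).mono fun x hx => hε.trans hx.1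
  have hderiv : ∀ x ∈ Set.Ioo ε t, HasDerivAt (ids lam) (dos lam x) x := fun x hx =>
    hasDerivAt_ids hlam (hε.trans_lt hx.1)
  have hint : IntegrableOn (dos lam) (Set.Ioc ε t) :=
    intervalIntegral.integrableOn_deriv_of_nonneg hcont hderiv fun x hx =>
      (dos_pos hlam (hε.trans_lt hx.1)).le
  rw [dosMeasure, withDensity_apply _ measurableSet_Ioc,
    ← intervalIntegral.integral_eq_sub_of_hasDerivAt_of_le ht hcont hderiv
      ((intervalIntegrable_iff_integrableOn_Ioc_of_le ht).2 hint),
    intervalIntegral.integral_of_le ht, ofReal_integral_eq_lintegral_ofReal hint]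
  filter_upwards [ae_restrict_mem measurableSet_Ioc] with x hx
    using (dos_pos hlam (hε.trans_lt hx.1)).le

lemma lintegral_bose_dosMeasure (hlam : 0 < lam) (hε : 0 ≤ ε) :
    ∫⁻ E in Set.Ioi ε, ENNReal.ofReal (bose β μ E) ∂dosMeasure lam
      = ∫⁻ E in Set.Ioi ε, ENNReal.ofReal (dos lam E * bose β μ E) := by
  rw [dosMeasure, setLIntegral_withDensity_eq_setLIntegral_mul _
    (measurable_dos lam).ennreal_ofReal (measurable_bose β μ).ennreal_ofReal measurableSet_Ioi]
  exact setLIntegral_congr_fun measurableSet_Ioi fun E hE =>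
    (ENNReal.ofReal_mul (dos_pos hlam (hε.trans_lt hE)).le).symm

/-! ### The limiting particle density -/

lemma exp_sub_one_eq_mul_sinh (u : ℝ) :
    Real.exp u - 1 = Real.exp (u / 2) * (2 * Real.sinh (u / 2)) := by
  rw [Real.sinh_eq, mul_div_cancel₀ _ two_ne_zero, mul_sub, ← Real.exp_add, ← Real.exp_add,
    add_halves, add_neg_cancel, Real.exp_zero]

lemma cube_div_le_two_mul_sinh_half {u : ℝ} (hu : 0 ≤ u) : u ^ 3 / 27 ≤ 2 * Real.sinh (u / 2) := by
  have hsinh : u / 6 ≤ Real.sinh (u / 6) := Real.self_le_sinh_iff.2 (by positivity)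
  have hcube : (u / 6) ^ 3 ≤ Real.sinh (u / 6) ^ 3 := by gcongr
  rw [show u / 2 = 3 * (u / 6) by ring, Real.sinh_three_mul]
  linarith [show u ^ 3 / 27 = 8 * (u / 6) ^ 3 by ring]

lemma exp_div_sq_exp_sub_one_le {u : ℝ} (hu : 0 < u) :
    Real.exp u / (Real.exp u - 1) ^ 2 ≤ 729 / u ^ 6 := by
  calc Real.exp u / (Real.exp u - 1) ^ 2 = 1 / (2 * Real.sinh (u / 2)) ^ 2 := by
        rw [exp_sub_one_eq_mul_sinh, mul_pow, ← Real.exp_nat_mul, Nat.cast_two,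
          mul_div_cancel₀ u two_ne_zero, div_mul_cancel_left₀ (Real.exp_ne_zero u), one_div]
    _ ≤ 1 / (u ^ 3 / 27) ^ 2 := by
        gcongr
        exact cube_div_le_two_mul_sinh_half hu.le
    _ = 729 / u ^ 6 := by field_simp; norm_num

lemma dos_le (hlam : 0 < lam) (hE : 0 < E) :
    dos lam E ≤ lam ^ 2 * cc / 2 * (729 / (cc * lam) ^ 6) * √E ^ 3 := by
  have hc := cc_pos
  have hsqrt := Real.sqrt_pos.2 hE
  calc dos lam E = lam ^ 2 * cc / 2 / √E ^ 3 *
        (Real.exp (cc * lam / √E) / (Real.exp (cc * lam / √E) - 1) ^ 2) := by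
        rw [dos, rpow_three_halves hE.le, mul_div_mul_comm]
    _ ≤ lam ^ 2 * cc / 2 / √E ^ 3 * (729 / (cc * lam / √E) ^ 6) := by
        exact mul_le_mul_of_nonneg_left (exp_div_sq_exp_sub_one_le (by positivity)) (by positivity)
    _ = lam ^ 2 * cc / 2 * (729 / (cc * lam) ^ 6) * √E ^ 3 := by field_simp

lemma bose_zero_le (hβ : 0 < β) (hE : 0 < E) :
    bose β 0 E ≤ 1 / (β * E) * Real.exp (-(β / 2 * E)) := by
  have hsinh : β * E ≤ 2 * Real.sinh (β * E / 2) := by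
    linarith [Real.self_le_sinh_iff.2 (show 0 ≤ β * E / 2 by positivity)]
  calc bose β 0 E = 1 / (Real.exp (β * E / 2) * (2 * Real.sinh (β * E / 2))) := by
        rw [bose, sub_zero, exp_sub_one_eq_mul_sinh]
    _ ≤ 1 / (Real.exp (β * E / 2) * (β * E)) := by gcongr
    _ = 1 / (β * E) * Real.exp (-(β / 2 * E)) := by
        rw [show -(β / 2 * E) = -(β * E / 2) by ring, Real.exp_neg, one_div, one_div, mul_inv_rev]

lemma integrableOn_dos_mul_bose_zero (hlam : 0 < lam) (hβ : 0 < β) :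
    IntegrableOn (fun E => dos lam E * bose β 0 E) (Set.Ioi 0) := by
  have hc := cc_pos
  set C := lam ^ 2 * cc / 2 * (729 / (cc * lam) ^ 6)
  refine ((integrableOn_sqrt_mul_exp_neg_mul (half_pos hβ)).const_mul (C / β)).mono'
    ((measurable_dos lam).mul (measurable_bose β 0)).aestronglyMeasurable ?_
  filter_upwards [ae_restrict_mem measurableSet_Ioi] with E hE
  rw [Set.mem_Ioi] at hE
  have hdos := dos_pos hlam hE
  have hbose := bose_pos hβ hE
  rw [Real.norm_of_nonneg (by positivity)]
  calc dos lam E * bose β 0 E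
      ≤ (C * √E ^ 3) * (1 / (β * E) * Real.exp (-(β / 2 * E))) := by
        gcongr
        exacts [dos_le hlam hE, bose_zero_le hβ hE]
    _ = C / β * (√E * Real.exp (-(β / 2 * E))) := by
        have hsq : √E ^ 3 = E * √E := by rw [pow_succ, Real.sq_sqrt hE.le]
        rw [hsq]
        field_simp

lemma dos_mul_bose_nonneg (hlam : 0 < lam) (hβ : 0 < β) (hμ : μ ≤ 0) (hE : 0 < E) :
    0 ≤ dos lam E * bose β μ E :=
  (mul_pos (dos_pos hlam hE) (bose_pos hβ (hμ.trans_lt hE))).le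

lemma norm_dos_mul_bose_le (hlam : 0 < lam) (hβ : 0 < β) (hμ : μ ≤ 0) (hE : 0 < E) :
    ‖dos lam E * bose β μ E‖ ≤ dos lam E * bose β 0 E := by
  rw [Real.norm_of_nonneg (dos_mul_bose_nonneg hlam hβ hμ hE)]
  exact mul_le_mul_of_nonneg_left (bose_le_bose hβ hμ hE) (dos_pos hlam hE).le

lemma ae_norm_dos_mul_bose_le (hlam : 0 < lam) (hβ : 0 < β) (hμ : μ ≤ 0) :
    ∀ᵐ E ∂volume.restrict (Set.Ioi 0), ‖dos lam E * bose β μ E‖ ≤ dos lam E * bose β 0 E :=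
  (ae_restrict_mem measurableSet_Ioi).mono fun _ => norm_dos_mul_bose_le hlam hβ hμ

lemma measurable_dos_mul_bose (lam β μ : ℝ) : Measurable fun E => dos lam E * bose β μ E :=
  (measurable_dos lam).mul (measurable_bose β μ)

lemma integrableOn_dos_mul_bose (hlam : 0 < lam) (hβ : 0 < β) (hμ : μ ≤ 0) :
    IntegrableOn (fun E => dos lam E * bose β μ E) (Set.Ioi 0) :=
  (integrableOn_dos_mul_bose_zero hlam hβ).mono'
    (measurable_dos_mul_bose lam β μ).aestronglyMeasurable (ae_norm_dos_mul_bose_le hlam hβ hμ)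

lemma lintegral_dos_mul_bose (hlam : 0 < lam) (hβ : 0 < β) (hμ : μ ≤ 0) (hε : 0 ≤ ε) :
    ∫⁻ E in Set.Ioi ε, ENNReal.ofReal (dos lam E * bose β μ E)
      = ENNReal.ofReal (∫ E in Set.Ioi ε, dos lam E * bose β μ E) := by
  rw [ofReal_integral_eq_lintegral_ofReal
    ((integrableOn_dos_mul_bose hlam hβ hμ).mono_set (Set.Ioi_subset_Ioi hε))]
  filter_upwards [ae_restrict_mem measurableSet_Ioi] with E hE
    using dos_mul_bose_nonneg hlam hβ hμ (hε.trans_lt hE)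

lemma continuousOn_rho (hlam : 0 < lam) (hβ : 0 < β) : ContinuousOn (rho lam β) (Set.Iic 0) := by
  intro μ₀ hμ₀
  refine continuousWithinAt_of_dominated (bound := fun E => dos lam E * bose β 0 E)
    (Eventually.of_forall fun μ => (measurable_dos_mul_bose lam β μ).aestronglyMeasurable)
    (eventually_mem_nhdsWithin.mono fun μ hμ => ae_norm_dos_mul_bose_le hlam hβ hμ)
    (integrableOn_dos_mul_bose_zero hlam hβ) ?_
  filter_upwards [ae_restrict_mem measurableSet_Ioi] with E hE
  exact ((continuousAt_bose hβ ((Set.mem_Iic.1 hμ₀).trans_lt hE)).const_mul _).continuousWithinAt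

lemma tendsto_bose_atBot (hβ : 0 < β) (E : ℝ) : Tendsto (fun m => bose β m E) atBot (𝓝 0) :=
  Tendsto.div_atTop tendsto_const_nhds <| tendsto_atTop_add_const_right _ (-1) <|
    Real.tendsto_exp_atTop.comp <|
      (tendsto_atTop_add_const_left _ E tendsto_neg_atBot_atTop).const_mul_atTop hβ

lemma tendsto_rho_atBot (hlam : 0 < lam) (hβ : 0 < β) : Tendsto (rho lam β) atBot (𝓝 0) := by
  have hlim := tendsto_integral_filter_of_dominated_convergence
    (F := fun m E => dos lam E * bose β m E) (f := fun E => dos lam E * 0)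
    (fun E => dos lam E * bose β 0 E)
    (Eventually.of_forall fun μ => (measurable_dos_mul_bose lam β μ).aestronglyMeasurable)
    ((eventually_le_atBot 0).mono fun μ hμ => ae_norm_dos_mul_bose_le hlam hβ hμ)
    (integrableOn_dos_mul_bose_zero hlam hβ)
    (Eventually.of_forall fun E => (tendsto_bose_atBot hβ E).const_mul _)
  simp only [mul_zero, integral_zero] at hlim
  exact hlim

lemma strictMonoOn_rho (hlam : 0 < lam) (hβ : 0 < β) : StrictMonoOn (rho lam β) (Set.Iic 0) := by
  intro μ hμ μ' hμ' h
  have hint := integrableOn_dos_mul_bose hlam hβ hμ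
  have hint' := integrableOn_dos_mul_bose hlam hβ hμ'
  have hpos : ∀ E ∈ Set.Ioi (0 : ℝ), 0 < dos lam E * bose β μ' E - dos lam E * bose β μ E :=
    fun E hE => sub_pos.2 <| mul_lt_mul_of_pos_left
      (bose_lt_bose hβ h ((Set.mem_Iic.1 hμ').trans_lt hE)) (dos_pos hlam hE)
  rw [← sub_pos, rho, rho, ← integral_sub hint' hint,
    setIntegral_pos_iff_support_of_nonneg_ae
      ((ae_restrict_mem measurableSet_Ioi).mono fun E hE => (hpos E hE).le) (hint'.sub hint),
    Set.inter_eq_right.2 fun E hE => Function.mem_support.2 (hpos E hE).ne', Real.volume_Ioi]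
  exact ENNReal.coe_lt_top

lemma tendsto_rho_zero (hlam : 0 < lam) (hβ : 0 < β) :
    Tendsto (fun μ => rho lam β μ) (𝓝[<] (0 : ℝ)) (𝓝 (rho lam β 0)) :=
  (continuousOn_rho hlam hβ 0 Set.self_mem_Iic).mono_left
    (nhdsWithin_mono _ Set.Iio_subset_Iic_self)

lemma rhoCrit_eq (hlam : 0 < lam) (hβ : 0 < β) : rhoCrit lam β = rho lam β 0 :=
  (tendsto_rho_zero hlam hβ).limUnder_eq

lemma exists_rho_eq {ρ : ℝ} (hlam : 0 < lam) (hβ : 0 < β) (hρ : 0 < ρ) (h : ρ < rho lam β 0) :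
    ∃ μ < 0, rho lam β μ = ρ := by
  obtain ⟨a, haρ, ha⟩ := (((tendsto_rho_atBot hlam hβ).eventually_lt_const hρ).and
    (eventually_lt_atBot 0)).exists
  obtain ⟨μ, hμ, hμρ⟩ := intermediate_value_Icc ha.le
    ((continuousOn_rho hlam hβ).mono Set.Icc_subset_Iic_self) ⟨haρ.le, h.le⟩
  refine ⟨μ, hμ.2.lt_of_ne ?_, hμρ⟩
  rintro rfl
  exact h.ne' hμρ

lemma tendsto_setIntegral_dos_mul_bose (hlam : 0 < lam) (hβ : 0 < β) (hμ : μ ≤ 0) :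
    Tendsto (fun ε => ∫ E in Set.Ioi ε, dos lam E * bose β μ E) (𝓝[>] 0) (𝓝 (rho lam β μ)) := by
  have hcover : AECover (volume.restrict (Set.Ioi (0 : ℝ))) (𝓝[>] (0 : ℝ)) fun ε => Set.Ioi ε :=
    aecover_Ioi_of_Ioi (tendsto_id.mono_left nhdsWithin_le_nhds)
  refine (hcover.integral_tendsto_of_countably_generated
    (integrableOn_dos_mul_bose hlam hβ hμ)).congr' ?_
  filter_upwards [self_mem_nhdsWithin] with ε hε
  rw [Measure.restrict_restrict measurableSet_Ioi,
    Set.inter_eq_left.2 (Set.Ioi_subset_Ioi (Set.mem_Ioi.1 hε).le)]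

end DensityOfStates

/-! ### Configurations with exponential void fractions -/

section HasPoissonVoids

variable {ι : Type*} {l : Filter ι} {L : ι → ℝ} {X : ι → Set ℝ} {lam β ε t : ℝ}

/-- The property of impurity configurations on which the asymptotics rest: finitely many impurities
in each volume, and void fractions converging to the probability `exp (-lam x)` that an interval of
length `x` contains no point of a Poisson process of intensity `lam`. -/
structure HasPoissonVoids (l : Filter ι) (L : ι → ℝ) (X : ι → Set ℝ) (lam : ℝ) : Prop where
  length_pos : ∀ᶠ i in l, 0 < L i
  finite : ∀ i, (X i ∩ Set.Ioo (-(L i / 2)) (L i / 2)).Finite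
  tendsto_voidFraction : ∀ x > 0,
    Tendsto (fun i => voidFraction (L i) (X i) x) l (𝓝 (Real.exp (-(lam * x))))

lemma HasPoissonVoids.tendsto_idsMeasure_Iic (h : HasPoissonVoids l L X lam) (hlam : 0 < lam)
    (ht : 0 ≤ t) :
    Tendsto (fun i => idsMeasure (L i) (X i) (Set.Iic t)) l (𝓝 (ENNReal.ofReal (ids lam t))) := by
  rcases ht.eq_or_lt with rfl | ht
  · simp only [idsMeasure_Iic_zero, ids_zero, ENNReal.ofReal_zero, tendsto_const_nhds]
  have (i : ι) : Finite (boxes (L i) (X i)) := boxes_finite (h.finite i)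
  have hfloor := tendsto_natFloor_div_of_tendsto_exp (A := fun i => boxAvg (L i) (X i)) hlam
    (div_pos cc_pos (Real.sqrt_pos.2 ht)) (h.length_pos.mono fun i hi => boxAvg_monotone hi (X i))
    fun x hx => (h.tendsto_voidFraction x hx).congr' <| h.length_pos.mono fun i hi =>
      voidFraction_eq_boxAvg hi (h.finite i) hx
  rw [← mul_div_assoc, mul_comm lam] at hfloor
  exact (ENNReal.tendsto_ofReal hfloor).congr' <| h.length_pos.mono fun i hi =>
    (idsMeasure_Iic hi (X i) ht).symm

lemma HasPoissonVoids.tendsto_idsMeasure_Ioc (h : HasPoissonVoids l L X lam) (hlam : 0 < lam)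
    (hε : 0 ≤ ε) (ht : ε < t) :
    Tendsto (fun i => idsMeasure (L i) (X i) (Set.Ioc ε t)) l
      (𝓝 (dosMeasure lam (Set.Ioc ε t))) := by
  have hids : 0 ≤ ids lam ε := by
    rcases hε.eq_or_lt with rfl | hε
    exacts [(ids_zero lam).ge, (ids_pos hlam hε).le]
  rw [dosMeasure_Ioc hlam hε ht.le, ENNReal.ofReal_sub _ hids]
  refine (ENNReal.Tendsto.sub (h.tendsto_idsMeasure_Iic hlam (hε.trans ht.le))
    (h.tendsto_idsMeasure_Iic hlam hε) (Or.inl ENNReal.ofReal_ne_top)).congr'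
    (h.length_pos.mono fun i hi => ?_)
  have : Finite (boxes (L i) (X i)) := boxes_finite (h.finite i)
  have hsub : Set.Iic ε ⊆ Set.Iic t := Set.Iic_subset_Iic.2 ht.le
  have hIoc : Set.Ioc ε t = Set.Iic t \ Set.Iic ε := by
    rw [Set.sdiff_eq, Set.compl_Iic, Set.inter_comm, Set.Ioi_inter_Iic]
  simp only [hIoc]
  refine (measure_sdiff hsub measurableSet_Iic.nullMeasurableSet ?_).symm
  exact ne_top_of_le_ne_top ENNReal.ofReal_ne_top
    ((measure_mono hsub).trans (idsMeasure_Iic_le hi (X i) (hε.trans_lt ht)))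

lemma HasPoissonVoids.tendsto_lintegral_bose [l.IsCountablyGenerated]
    (h : HasPoissonVoids l L X lam) (hlam : 0 < lam) (hβ : 0 < β) (hε : 0 ≤ ε) {μ : ι → ℝ} {μ₀ : ℝ}
    (hμ : Tendsto μ l (𝓝 μ₀)) (hμ₀ : μ₀ ≤ 0) (hμε : μ₀ < ε) :
    Tendsto (fun i => ∫⁻ E in Set.Ioi ε, ENNReal.ofReal (bose β (μ i) E) ∂idsMeasure (L i) (X i)) l
      (𝓝 (ENNReal.ofReal (∫ E in Set.Ioi ε, dos lam E * bose β μ₀ E))) := by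
  have (i : ι) : Finite (boxes (L i) (X i)) := boxes_finite (h.finite i)
  rw [← lintegral_dos_mul_bose hlam hβ hμ₀ hε, ← lintegral_bose_dosMeasure hlam hε]
  refine tendsto_lintegral_bose_of_tendsto_measure_Ioc (C := 1 / cc) hβ hε hμ hμε
    (h.length_pos.mono fun i hi t ht => ?_) fun t ht => h.tendsto_idsMeasure_Ioc hlam hε ht
  rw [one_div_mul_eq_div]
  exact (measure_mono Set.Ioc_subset_Iic_self).trans
    (idsMeasure_Iic_le hi (X i) (hε.trans_lt ht))

end HasPoissonVoids

/-! ### The density equation in a finite volume -/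

section BoseSeries

variable {κ : Type*} {E : κ → ℝ} {β b r m m' : ℝ}

lemma tendsto_bose_nhdsLT (hβ : 0 < β) (t : ℝ) :
    Tendsto (fun m => bose β m t) (𝓝[<] t) atTop := by
  have hcont : Continuous fun m => Real.exp (β * (t - m)) - 1 := by fun_prop
  have hden : Tendsto (fun m => Real.exp (β * (t - m)) - 1) (𝓝[<] t) (𝓝[>] 0) :=
    tendsto_nhdsWithin_iff.2 ⟨tendsto_nhdsWithin_of_tendsto_nhds (by
      simpa only [sub_self, mul_zero, Real.exp_zero] using hcont.tendsto t),
      eventually_nhdsWithin_of_forall fun _ => exp_mul_sub_sub_one_pos hβ⟩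
  simpa only [bose, one_div] using! tendsto_inv_nhdsGT_zero.comp hden

lemma norm_bose_le_bose (hβ : 0 < β) (hE : ∀ q, b < E q) (hm : m ≤ b) (q : κ) :
    ‖bose β m (E q)‖ ≤ bose β b (E q) := by
  rw [Real.norm_of_nonneg (bose_pos hβ (hm.trans_lt (hE q))).le]
  exact bose_le_bose hβ hm (hE q)

lemma continuousOn_tsum_bose (hβ : 0 < β) (hE : ∀ q, b < E q)
    (hsum : Summable fun q => bose β b (E q)) :
    ContinuousOn (fun m => ∑' q, bose β m (E q)) (Set.Iic b) :=
  continuousOn_tsum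
    (fun q _ hm => (continuousAt_bose hβ (lt_of_le_of_lt hm (hE q))).continuousWithinAt) hsum
    fun q _ hm => norm_bose_le_bose hβ hE hm q

lemma tendsto_tsum_bose_atBot (hβ : 0 < β) (hE : ∀ q, b < E q)
    (hsum : Summable fun q => bose β b (E q)) :
    Tendsto (fun m => ∑' q, bose β m (E q)) atBot (𝓝 0) := by
  simpa only [tsum_zero] using tendsto_tsum_of_dominated_convergence hsum
    (fun q => tendsto_bose_atBot hβ (E q))
    ((eventually_le_atBot b).mono fun m hm => norm_bose_le_bose hβ hE hm)

lemma eq_of_hasSum_bose [Nonempty κ] (hβ : 0 < β) (hm : ∀ q, m < E q) (hm' : ∀ q, m' < E q)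
    (h : HasSum (fun q => bose β m (E q)) r) (h' : HasSum (fun q => bose β m' (E q)) r) :
    m = m' := by
  have hnot : ∀ {a b}, HasSum (fun q => bose β a (E q)) r → HasSum (fun q => bose β b (E q)) r →
      (∀ q, b < E q) → ¬ a < b := fun ha hb hbE hab =>
    lt_irrefl r <| hasSum_lt (fun q => (bose_lt_bose hβ hab (hbE q)).le)
      (bose_lt_bose hβ hab (hbE (Classical.arbitrary κ))) ha hb
  exact le_antisymm (not_lt.1 (hnot h' h hm)) (not_lt.1 (hnot h h' hm'))

lemma existsUnique_hasSum_bose (hβ : 0 < β) (hr : 0 < r) {q₀ : κ} (hmin : ∀ q, E q₀ ≤ E q)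
    (hsum : ∀ m < E q₀, Summable fun q => bose β m (E q)) :
    ∃! m, (∀ q, m < E q) ∧ HasSum (fun q => bose β m (E q)) r := by
  have : Nonempty κ := ⟨q₀⟩
  refine existsUnique_of_exists_of_unique ?_
    fun m m' hm hm' => eq_of_hasSum_bose hβ hm.1 hm'.1 hm.2 hm'.2
  obtain ⟨b, hrb, hb⟩ := ((tendsto_bose_nhdsLT hβ (E q₀)).eventually_ge_atTop r |>.and
    eventually_mem_nhdsWithin).exists
  have hbE : ∀ q, b < E q := fun q => (Set.mem_Iio.1 hb).trans_le (hmin q)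
  have hSb : r ≤ ∑' q, bose β b (E q) :=
    hrb.trans ((hsum b hb).le_tsum q₀ fun q _ => (bose_pos hβ (hbE q)).le)
  obtain ⟨a, hSa, hab⟩ := ((tendsto_tsum_bose_atBot hβ hbE (hsum b hb)).eventually_le_const hr
    |>.and (eventually_le_atBot b)).exists
  obtain ⟨m, hm, hmr⟩ := intermediate_value_Icc hab
    ((continuousOn_tsum_bose hβ hbE (hsum b hb)).mono Set.Icc_subset_Iic_self) ⟨hSa, hSb⟩
  exact ⟨m, fun q => hm.2.trans_lt (hbE q), hmr ▸ (hsum m (hm.2.trans_lt hb)).hasSum⟩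

end BoseSeries

section FiniteVolume

variable {L β ρ μ ν ε m : ℝ} {X : Set ℝ}

lemma level_eq_sq_mul (p : boxes L X) (k : ℕ) :
    level L X (p, k) = ((k + 1 : ℕ) : ℝ) ^ 2 * level L X (p, 0) := by
  simp only [level, energy]; push_cast; ring

lemma level_zero_le (p : boxes L X) (k : ℕ) : level L X (p, 0) ≤ level L X (p, k) := by
  rw [level_eq_sq_mul p k]
  exact le_mul_of_one_le_left (level_pos _).le (one_le_pow₀ (mod_cast Nat.le_add_left 1 k))

lemma exists_min_level (L : ℝ) (X : Set ℝ) [Finite (boxes L X)] [Nonempty (boxes L X)] :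
    ∃ q₀, ∀ q, level L X q₀ ≤ level L X q := by
  obtain ⟨p, hp⟩ := Finite.exists_min fun p : boxes L X => level L X (p, 0)
  exact ⟨(p, 0), fun q => (hp q.1).trans (level_zero_le _ _)⟩

lemma sq_mul_le_level_sub (p : boxes L X) (k : ℕ) :
    ((k + 1 : ℕ) : ℝ) ^ 2 * (level L X (p, 0) - max m 0) ≤ level L X (p, k) - m := by
  have hk : (1 : ℝ) ≤ ((k + 1 : ℕ) : ℝ) ^ 2 := one_le_pow₀ (mod_cast Nat.le_add_left 1 k)
  rw [level_eq_sq_mul p k, mul_sub]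
  linarith [le_max_left m 0, le_mul_of_one_le_left (le_max_right m 0) hk]

lemma summable_bose_level [Finite (boxes L X)] (hβ : 0 < β) (hm : ∀ q, m < level L X q) :
    Summable fun q => bose β m (level L X q) := by
  rw [summable_prod_of_nonneg fun q => (bose_pos hβ (hm q)).le]
  refine ⟨fun p => ?_, Summable.of_finite⟩
  set c := level L X (p, 0) - max m 0
  have hc_pos : 0 < c := sub_pos.2 (max_lt (hm _) (level_pos _))
  have hsum : Summable fun k : ℕ => 1 / (β * c) * (1 / ((k + 1 : ℕ) : ℝ) ^ 2) :=
    ((summable_nat_add_iff 1).2 (Real.summable_one_div_nat_pow.2 one_lt_two)).mul_left _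
  refine hsum.of_nonneg_of_le (fun k => (bose_pos hβ (hm _)).le) fun k => ?_
  calc bose β m (level L X (p, k))
      ≤ 1 / (β * (level L X (p, k) - m)) := one_div_le_one_div_of_le
        (mul_pos hβ (sub_pos.2 (hm _)))
        (le_sub_iff_add_le.2 (Real.add_one_le_exp (β * (level L X (p, k) - m))))
    _ ≤ 1 / (β * (((k + 1 : ℕ) : ℝ) ^ 2 * c)) := by
        gcongr
        exact sq_mul_le_level_sub p k
    _ = 1 / (β * c) * (1 / ((k + 1 : ℕ) : ℝ) ^ 2) := by field_simp

theorem existsUnique_solvesDensityEq (hL : 0 < L) (hβ : 0 < β) (hρ : 0 < ρ)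
    (hX : (X ∩ Set.Ioo (-(L / 2)) (L / 2)).Finite) : ∃! m : ℝ, SolvesDensityEq L X β ρ m := by
  have : Finite (boxes L X) := boxes_finite hX
  have : Nonempty (boxes L X) := (boxes_nonempty hL hX).to_subtype
  obtain ⟨q₀, hq₀⟩ := exists_min_level L X
  have hscale : 1 / L * (L * ρ) = ρ := by field_simp
  have hiff (m : ℝ) : SolvesDensityEq L X β ρ m ↔
      (∀ q, m < level L X q) ∧ HasSum (fun q => bose β m (level L X q)) (L * ρ) := by
    rw [SolvesDensityEq, ← hasSum_mul_left_iff (a₁ := L * ρ) (one_div_ne_zero hL.ne'), hscale]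
  simp only [hiff]
  exact existsUnique_hasSum_bose hβ (mul_pos hL hρ) hq₀ fun m hm =>
    summable_bose_level hβ fun q => hm.trans_le (hq₀ q)

lemma lintegral_Ioi_bose_idsMeasure (L : ℝ) (X : Set ℝ) (β μ : ℝ) :
    ∫⁻ E in Set.Ioi 0, ENNReal.ofReal (bose β μ E) ∂idsMeasure L X
      = ENNReal.ofReal (1 / L) * ∑' q, ENNReal.ofReal (bose β μ (level L X q)) := by
  rw [← lintegral_indicator measurableSet_Ioi, lintegral_idsMeasure L X
    ((measurable_bose β μ).ennreal_ofReal.indicator measurableSet_Ioi)]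
  simp only [Set.indicator_of_mem (Set.mem_Ioi.2 (level_pos _))]

lemma SolvesDensityEq.lintegral_eq (h : SolvesDensityEq L X β ρ μ) (hL : 0 < L) (hβ : 0 < β) :
    ∫⁻ E in Set.Ioi 0, ENNReal.ofReal (bose β μ E) ∂idsMeasure L X = ENNReal.ofReal ρ := by
  rw [lintegral_Ioi_bose_idsMeasure, ← h.2.tsum_eq, ← ENNReal.tsum_mul_left,
    ENNReal.ofReal_tsum_of_nonneg (fun q => mul_nonneg (by positivity) (bose_pos hβ (h.1 q)).le)
      h.2.summable]
  exact tsum_congr fun q => (ENNReal.ofReal_mul (by positivity)).symm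

lemma SolvesDensityEq.lintegral_le (h : SolvesDensityEq L X β ρ μ) (hL : 0 < L) (hβ : 0 < β)
    (hν : ν ≤ μ) :
    ∫⁻ E in Set.Ioi 0, ENNReal.ofReal (bose β ν E) ∂idsMeasure L X ≤ ENNReal.ofReal ρ := by
  rw [← h.lintegral_eq hL hβ, lintegral_Ioi_bose_idsMeasure, lintegral_Ioi_bose_idsMeasure]
  gcongr with q
  exact bose_le_bose hβ hν (h.1 q)

lemma SolvesDensityEq.le_lintegral (h : SolvesDensityEq L X β ρ μ) (hL : 0 < L) (hβ : 0 < β)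
    (hν : μ ≤ ν) (hν₀ : ν ≤ 0) :
    ENNReal.ofReal ρ ≤ ∫⁻ E in Set.Ioi 0, ENNReal.ofReal (bose β ν E) ∂idsMeasure L X := by
  rw [← h.lintegral_eq hL hβ, lintegral_Ioi_bose_idsMeasure, lintegral_Ioi_bose_idsMeasure]
  gcongr with q
  exact bose_le_bose hβ hν (hν₀.trans_lt (level_pos q))

lemma SolvesDensityEq.idsMeasure_Iic_eq_zero (h : SolvesDensityEq L X β ρ μ) :
    idsMeasure L X (Set.Iic μ) = 0 := by
  simp only [idsMeasure_apply measurableSet_Iic, Set.indicator, Set.mem_Iic, (h.1 _).not_ge,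
    if_false, tsum_zero, mul_zero]

lemma SolvesDensityEq.ae_lt (h : SolvesDensityEq L X β ρ μ) : ∀ᵐ E ∂idsMeasure L X, μ < E := by
  simpa only [ae_iff, not_lt] using! h.idsMeasure_Iic_eq_zero

lemma SolvesDensityEq.lowEnergyDensity_eq (h : SolvesDensityEq L X β ρ μ) (hL : 0 < L)
    (hβ : 0 < β) (hρ : 0 ≤ ρ) (hε : 0 ≤ ε) :
    lowEnergyDensity L X β μ ε
      = ρ - (∫⁻ E in Set.Ioi ε, ENNReal.ofReal (bose β μ E) ∂idsMeasure L X).toReal := by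
  have hsplit := h.lintegral_eq hL hβ
  rw [← Set.Ioc_union_Ioi_eq_Ioi hε, lintegral_union measurableSet_Ioi
    (Set.disjoint_left.2 fun x hx hx' => not_lt.2 hx.2 hx')] at hsplit
  obtain ⟨hlow, hhigh⟩ := ENNReal.add_ne_top.1 (hsplit.trans_ne ENNReal.ofReal_ne_top)
  have htoReal := congrArg ENNReal.toReal hsplit
  rw [ENNReal.toReal_add hlow hhigh, ENNReal.toReal_ofReal hρ] at htoReal
  rw [← htoReal, add_sub_cancel_right, lowEnergyDensity, integral_eq_lintegral_of_nonneg_ae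
    ((ae_restrict_of_ae h.ae_lt).mono fun E hE => (bose_pos hβ hE).le)
    (measurable_bose β μ).aestronglyMeasurable]

end FiniteVolume

/-! ### Asymptotics of the chemical potential and of the condensate -/

section Asymptotics

variable {ι : Type*} {l : Filter ι} {L : ι → ℝ} {X : ι → Set ℝ} {lam β ρ ε ν μ₀ : ℝ} {μ : ι → ℝ}

lemma HasPoissonVoids.eventually_lt_of_pos (h : HasPoissonVoids l L X lam) (hlam : 0 < lam)
    (hμ : ∀ᶠ i in l, SolvesDensityEq (L i) (X i) β ρ (μ i)) {t : ℝ} (ht : 0 < t) :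
    ∀ᶠ i in l, μ i < t := by
  filter_upwards [hμ, (h.tendsto_idsMeasure_Iic hlam ht.le).eventually_const_lt
    (ENNReal.ofReal_pos.2 (ids_pos hlam ht))] with i hsol hpos
  by_contra! hle
  exact hpos.ne' (measure_mono_null (Set.Iic_subset_Iic.2 hle) hsol.idsMeasure_Iic_eq_zero)

variable [l.IsCountablyGenerated]

lemma HasPoissonVoids.tendsto_density (h : HasPoissonVoids l L X lam) (hlam : 0 < lam)
    (hβ : 0 < β) (hν : ν < 0) :
    Tendsto (fun i => ∫⁻ E in Set.Ioi 0, ENNReal.ofReal (bose β ν E) ∂idsMeasure (L i) (X i)) l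
      (𝓝 (ENNReal.ofReal (rho lam β ν))) :=
  h.tendsto_lintegral_bose hlam hβ le_rfl tendsto_const_nhds hν.le hν

lemma HasPoissonVoids.eventually_lt (h : HasPoissonVoids l L X lam) (hlam : 0 < lam) (hβ : 0 < β)
    (hρ : 0 < ρ) (hμ : ∀ᶠ i in l, SolvesDensityEq (L i) (X i) β ρ (μ i)) (hν : ν < 0)
    (hνρ : rho lam β ν < ρ) : ∀ᶠ i in l, ν < μ i := by
  filter_upwards [hμ, h.length_pos, (h.tendsto_density hlam hβ hν).eventually_lt_const
    ((ENNReal.ofReal_lt_ofReal_iff hρ).2 hνρ)] with i hsol hL hlt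
  by_contra! hle
  exact hlt.not_ge (hsol.le_lintegral hL hβ hle hν.le)

lemma HasPoissonVoids.eventually_gt (h : HasPoissonVoids l L X lam) (hlam : 0 < lam) (hβ : 0 < β)
    (hρ : 0 < ρ) (hμ : ∀ᶠ i in l, SolvesDensityEq (L i) (X i) β ρ (μ i)) (hν : ν < 0)
    (hνρ : ρ < rho lam β ν) : ∀ᶠ i in l, μ i < ν := by
  filter_upwards [hμ, h.length_pos, (h.tendsto_density hlam hβ hν).eventually_const_lt
    ((ENNReal.ofReal_lt_ofReal_iff (hρ.trans hνρ)).2 hνρ)] with i hsol hL hlt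
  by_contra! hle
  exact hlt.not_ge (hsol.lintegral_le hL hβ hle)

lemma HasPoissonVoids.tendsto_chemicalPotential_of_lt (h : HasPoissonVoids l L X lam)
    (hlam : 0 < lam) (hβ : 0 < β) (hρ : 0 < ρ)
    (hμ : ∀ᶠ i in l, SolvesDensityEq (L i) (X i) β ρ (μ i)) (hμ₀ : μ₀ < 0)
    (hroot : rho lam β μ₀ = ρ) : Tendsto μ l (𝓝 μ₀) := by
  have hmono := strictMonoOn_rho hlam hβ
  refine tendsto_order.2 ⟨fun a ha => ?_, fun b hb => ?_⟩
  · exact h.eventually_lt hlam hβ hρ hμ (ha.trans hμ₀)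
      (hroot ▸ hmono (ha.trans hμ₀).le hμ₀.le ha)
  · obtain ⟨c, hμ₀c, hc⟩ := exists_between (lt_min hb hμ₀)
    have hc₀ : c < 0 := hc.trans_le (min_le_right b 0)
    exact (h.eventually_gt hlam hβ hρ hμ hc₀ (hroot ▸ hmono hμ₀.le hc₀.le hμ₀c)).mono fun i hi =>
      hi.trans (hc.trans_le (min_le_left b 0))

lemma HasPoissonVoids.tendsto_chemicalPotential_of_ge (h : HasPoissonVoids l L X lam)
    (hlam : 0 < lam) (hβ : 0 < β) (hρ : 0 < ρ)
    (hμ : ∀ᶠ i in l, SolvesDensityEq (L i) (X i) β ρ (μ i)) (hcrit : rho lam β 0 ≤ ρ) :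
    Tendsto μ l (𝓝 0) :=
  tendsto_order.2 ⟨fun _ ha => h.eventually_lt hlam hβ hρ hμ ha
      ((strictMonoOn_rho hlam hβ ha.le Set.self_mem_Iic ha).trans_le hcrit),
    fun _ hb => h.eventually_lt_of_pos hlam hμ hb⟩

lemma HasPoissonVoids.tendsto_lowEnergyDensity (h : HasPoissonVoids l L X lam) (hlam : 0 < lam)
    (hβ : 0 < β) (hρ : 0 ≤ ρ) (hμ : ∀ᶠ i in l, SolvesDensityEq (L i) (X i) β ρ (μ i))
    (hμ₀ : μ₀ ≤ 0) (hlim : Tendsto μ l (𝓝 μ₀)) (hε : 0 < ε) :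
    Tendsto (fun i => lowEnergyDensity (L i) (X i) β (μ i) ε) l
      (𝓝 (ρ - ∫ E in Set.Ioi ε, dos lam E * bose β μ₀ E)) := by
  have hnonneg : 0 ≤ ∫ E in Set.Ioi ε, dos lam E * bose β μ₀ E :=
    setIntegral_nonneg measurableSet_Ioi fun E hE =>
      dos_mul_bose_nonneg hlam hβ hμ₀ (hε.trans hE)
  have hhigh := ((ENNReal.tendsto_toReal ENNReal.ofReal_ne_top).comp
    (h.tendsto_lintegral_bose hlam hβ hε.le hlim hμ₀ (hμ₀.trans_lt hε))).const_sub ρ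
  rw [ENNReal.toReal_ofReal hnonneg] at hhigh
  refine hhigh.congr' ?_
  filter_upwards [hμ, h.length_pos] with i hsol hL
  exact (hsol.lowEnergyDensity_eq hL hβ hρ hε.le).symm

end Asymptotics

section AlmostSure

variable {Ω ι : Type*} [MeasurableSpace Ω] {P : Measure Ω} {l : Filter ι} [l.IsCountablyGenerated]
  {L : ι → ℝ} {X : ι → Ω → Set ℝ} {lam β ρ μ₀ : ℝ} {μ : ι → Ω → ℝ}

lemma exists_tendsto_lowEnergyDensity (hlam : 0 < lam) (hβ : 0 < β) (hρ : 0 ≤ ρ)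
    (h : ∀ᵐ ω ∂P, HasPoissonVoids l L (fun i => X i ω) lam)
    (hμ : ∀ᵐ ω ∂P, ∀ᶠ i in l, SolvesDensityEq (L i) (X i ω) β ρ (μ i ω)) (hμ₀ : μ₀ ≤ 0)
    (hlim : ∀ᵐ ω ∂P, Tendsto (fun i => μ i ω) l (𝓝 μ₀)) :
    ∃ g : ℝ → ℝ,
      (∀ ε > 0, ∀ᵐ ω ∂P,
        Tendsto (fun i => lowEnergyDensity (L i) (X i ω) β (μ i ω) ε) l (𝓝 (g ε))) ∧
      Tendsto g (𝓝[>] 0) (𝓝 (ρ - rho lam β μ₀)) := by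
  refine ⟨fun ε => ρ - ∫ E in Set.Ioi ε, dos lam E * bose β μ₀ E, fun ε hε => ?_,
    (tendsto_setIntegral_dos_mul_bose hlam hβ hμ₀).const_sub ρ⟩
  filter_upwards [h, hμ, hlim] with ω hvoids hsol hω
    using hvoids.tendsto_lowEnergyDensity hlam hβ hρ hsol hμ₀ hω hε

theorem condensationAsymptotics_of_hasPoissonVoids (hlam : 0 < lam) (hβ : 0 < β) (hρ : 0 < ρ)
    (h : ∀ᵐ ω ∂P, HasPoissonVoids l L (fun i => X i ω) lam) :
    CondensationAsymptotics P l L X lam β ρ := by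
  refine ⟨h.mono fun ω hω i hi => existsUnique_solvesDensityEq hi hβ hρ (hω.finite i),
    fun μ hμ => ⟨fun hsub => ?_, fun hcrit => ?_⟩⟩
  · rw [rhoCrit_eq hlam hβ] at hsub
    obtain ⟨μ₀, hμ₀, hroot⟩ := exists_rho_eq hlam hβ hρ hsub
    have hunique : ∀ m < 0, rho lam β m = ρ → m = μ₀ := fun m hm hmρ =>
      (strictMonoOn_rho hlam hβ).injOn hm.le hμ₀.le (hmρ.trans hroot.symm)
    have hlim : ∀ᵐ ω ∂P, Tendsto (fun i => μ i ω) l (𝓝 μ₀) := by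
      filter_upwards [h, hμ] with ω hvoids hsol
        using hvoids.tendsto_chemicalPotential_of_lt hlam hβ hρ hsol hμ₀ hroot
    refine ⟨⟨μ₀, hμ₀, hroot, hunique, hlim⟩, ?_⟩
    simpa only [hroot, sub_self] using
      exists_tendsto_lowEnergyDensity hlam hβ hρ.le h hμ hμ₀.le hlim
  · rw [rhoCrit_eq hlam hβ] at hcrit ⊢
    have hlim : ∀ᵐ ω ∂P, Tendsto (fun i => μ i ω) l (𝓝 0) := by
      filter_upwards [h, hμ] with ω hvoids hsol
        using hvoids.tendsto_chemicalPotential_of_ge hlam hβ hρ hsol hcrit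
    exact ⟨hlim, exists_tendsto_lowEnergyDensity hlam hβ hρ.le h hμ le_rfl hlim⟩

end AlmostSure

lemma HasPoissonVoids.of_rat {ι : Type*} {l : Filter ι} {L : ι → ℝ} {X : ι → Set ℝ} {lam : ℝ}
    (hL : ∀ᶠ i in l, 0 < L i) (hfin : ∀ i, (X i ∩ Set.Ioo (-(L i / 2)) (L i / 2)).Finite)
    (h : ∀ q : ℚ, (0 : ℝ) < q →
      Tendsto (fun i => voidFraction (L i) (X i) q) l (𝓝 (Real.exp (-(lam * q))))) :
    HasPoissonVoids l L X lam where
  length_pos := hL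
  finite := hfin
  tendsto_voidFraction x hx := by
    refine tendsto_of_antitone_of_dense (F := fun i => voidFraction (L i) (X i))
      Rat.denseRange_cast (hL.mono fun i hi => voidFraction_antitone hi (X i)) ?_
      (f := fun x => Real.exp (-(lam * x))) (by fun_prop)
    filter_upwards [self_mem_nhdsWithin, mem_nhdsWithin_of_mem_nhds (lt_mem_nhds hx)]
    rintro _ ⟨q, rfl⟩ hq
    exact h q hq

/-! ### Independent uniform impurities -/

section Uniform

variable {ι : Type*} {L x y : ℝ}

lemma mem_voidSet_range {ξ : ι → ℝ} : y ∈ voidSet L (Set.range ξ) x ↔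
    y ∈ Set.Icc (-(L / 2)) (L / 2 - x) ∧ ∀ i, ξ i ∈ (Set.Ioo y (y + x))ᶜ := by
  simp only [voidSet, Set.disjoint_right, Set.forall_mem_range, Set.mem_ofPred_eq, Set.mem_Icc,
    Set.mem_compl_iff, le_sub_iff_add_le, and_assoc]

lemma measurableSet_setOf_mem_voidSet_range [Countable ι] (L x : ℝ) :
    MeasurableSet {p : (ι → ℝ) × ℝ | p.2 ∈ voidSet L (Set.range p.1) x} := by
  simp only [mem_voidSet_range]
  refine (measurable_snd measurableSet_Icc).inter ?_
  change MeasurableSet {p : (ι → ℝ) × ℝ | ∀ i, p.1 i ∈ (Set.Ioo p.2 (p.2 + x))ᶜ}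
  rw [Set.ofPred_forall]
  refine MeasurableSet.iInter fun i => ?_
  have hi : Measurable fun p : (ι → ℝ) × ℝ => p.1 i :=
    (measurable_pi_apply i).comp measurable_fst
  exact ((measurableSet_lt measurable_snd hi).inter
    (measurableSet_lt hi (measurable_snd.add_const x))).compl

lemma measurable_volume_voidSet_range [Countable ι] (L x : ℝ) :
    Measurable fun ξ : ι → ℝ => volume (voidSet L (Set.range ξ) x) :=
  measurable_measure_prodMk_left (measurableSet_setOf_mem_voidSet_range L x)

lemma measurable_voidFraction_range [Countable ι] (L x : ℝ) :
    Measurable fun ξ : ι → ℝ => voidFraction L (Set.range ξ) x :=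
  (measurable_volume_voidSet_range L x).ennreal_toReal.const_mul (1 / L)

lemma voidFraction_range_sub_update_le [DecidableEq ι] (hL : 0 < L) (hx : 0 ≤ x) (ξ : ι → ℝ)
    (i : ι) (a : ℝ) :
    voidFraction L (Set.range ξ) x - voidFraction L (Set.range (Function.update ξ i a)) x
      ≤ x / L := by
  set V := voidSet L (Set.range ξ) x
  set W := voidSet L (Set.range (Function.update ξ i a)) x
  have hsub : V \ W ⊆ Set.Ioo (a - x) a := by
    rintro y ⟨hyV, hyW⟩
    rw [mem_voidSet_range] at hyV hyW
    by_contra hya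
    refine hyW ⟨hyV.1, fun j => ?_⟩
    by_cases hj : j = i
    · subst hj
      rw [Function.update_self]
      exact fun h => hya ⟨by linarith [h.2], h.1⟩
    · rw [Function.update_of_ne hj]
      exact hyV.2 j
  have hvol : volume.real V - volume.real W ≤ x := by
    calc volume.real V - volume.real W ≤ volume.real (V \ W) :=
          le_measureReal_sdiff (volume_voidSet_ne_top _ _ _)
      _ ≤ volume.real (Set.Ioo (a - x) a) := measureReal_mono hsub measure_Ioo_lt_top.ne
      _ = x := by rw [Real.volume_real_Ioo_of_le (by linarith), sub_sub_cancel]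
  rw [voidFraction, voidFraction, ← mul_sub, one_div_mul_eq_div]
  gcongr

lemma hasBoundedDifferences_voidFraction_range [DecidableEq ι] (hL : 0 < L) (hx : 0 ≤ x) :
    HasBoundedDifferences (fun ξ : ι → ℝ => voidFraction L (Set.range ξ) x)
      fun _ => (x / L).toNNReal := fun ξ i a => by
  have hback := voidFraction_range_sub_update_le hL hx (Function.update ξ i a) i (ξ i)
  rw [Function.update_idem, Function.update_eq_self] at hback
  rw [Real.coe_toNNReal _ (by positivity), abs_sub_le_iff]
  exact ⟨voidFraction_range_sub_update_le hL hx ξ i a, hback⟩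

lemma voidFraction_mem_Icc (hL : 0 < L) (X : Set ℝ) (hx : 0 ≤ x) :
    voidFraction L X x ∈ Set.Icc 0 1 := by
  refine ⟨by unfold voidFraction; positivity, ?_⟩
  rw [voidFraction, one_div, inv_mul_le_iff₀ hL, mul_one]
  calc volume.real (voidSet L X x) ≤ volume.real (Set.Icc (-(L / 2)) (L / 2)) :=
        measureReal_mono ((voidSet_subset_Icc L X x).trans
          (Set.Icc_subset_Icc_right (by linarith))) measure_Icc_lt_top.ne
    _ = L := by rw [Real.volume_real_Icc_of_le (by linarith)]; ring

/-- The uniform law on the volume `[-L / 2, L / 2]`. -/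
def uniformLaw (L : ℝ) : Measure ℝ := volume[|Set.Icc (-(L / 2)) (L / 2)]

lemma isProbabilityMeasure_uniformLaw (hL : 0 < L) : IsProbabilityMeasure (uniformLaw L) := by
  refine cond_isProbabilityMeasure_of_finite ?_ measure_Icc_lt_top.ne
  rw [Real.volume_Icc, sub_neg_eq_add, add_halves]
  exact (ENNReal.ofReal_pos.2 hL).ne'

lemma uniformLaw_compl_Ioo (hL : 0 < L) (hx : 0 ≤ x)
    (hy : y ∈ Set.Icc (-(L / 2)) (L / 2 - x)) :
    uniformLaw L (Set.Ioo y (y + x))ᶜ = ENNReal.ofReal (1 - x / L) := by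
  have := isProbabilityMeasure_uniformLaw hL
  have hsub : Set.Ioo y (y + x) ⊆ Set.Icc (-(L / 2)) (L / 2) := fun z hz =>
    ⟨hy.1.trans hz.1.le, by linarith [hz.2, hy.2]⟩
  have hIoo : uniformLaw L (Set.Ioo y (y + x)) = ENNReal.ofReal (x / L) := by
    rw [uniformLaw, cond_apply measurableSet_Icc, Set.inter_eq_right.2 hsub, Real.volume_Icc,
      Real.volume_Ioo, sub_neg_eq_add, add_halves, add_sub_cancel_left, mul_comm,
      ENNReal.ofReal_div_of_pos hL, div_eq_mul_inv]
  rw [prob_compl_eq_one_sub measurableSet_Ioo, hIoo, ENNReal.ofReal_sub _ (by positivity),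
    ENNReal.ofReal_one]

variable [Fintype ι]

lemma pi_uniformLaw_setOf_mem_voidSet_range (hL : 0 < L) (hx : 0 ≤ x) (hxL : x ≤ L) (y : ℝ) :
    Measure.pi (fun _ : ι => uniformLaw L) {ξ | y ∈ voidSet L (Set.range ξ) x}
      = (Set.Icc (-(L / 2)) (L / 2 - x)).indicator
        (fun _ => ENNReal.ofReal ((1 - x / L) ^ Fintype.card ι)) y := by
  have := isProbabilityMeasure_uniformLaw hL
  simp only [mem_voidSet_range]
  by_cases hy : y ∈ Set.Icc (-(L / 2)) (L / 2 - x)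
  · have hpi : {ξ : ι → ℝ | y ∈ Set.Icc (-(L / 2)) (L / 2 - x) ∧
        ∀ i, ξ i ∈ (Set.Ioo y (y + x))ᶜ} = Set.univ.pi fun _ => (Set.Ioo y (y + x))ᶜ := by
      ext ξ
      simp only [hy, true_and, Set.mem_ofPred_eq, Set.mem_univ_pi]
    rw [Set.indicator_of_mem hy, hpi, Measure.pi_pi, Finset.prod_const,
      uniformLaw_compl_Ioo hL hx hy, Finset.card_univ,
      ENNReal.ofReal_pow (sub_nonneg.2 ((div_le_one hL).2 hxL))]
  · simp only [hy, false_and, Set.ofPred_false, measure_empty, not_false_eq_true,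
      Set.indicator_of_notMem]

lemma lintegral_volume_voidSet_range (hL : 0 < L) (hx : 0 ≤ x) (hxL : x ≤ L) :
    ∫⁻ ξ, volume (voidSet L (Set.range ξ) x) ∂Measure.pi (fun _ : ι => uniformLaw L)
      = ENNReal.ofReal (L * (1 - x / L) ^ (Fintype.card ι + 1)) := by
  have := isProbabilityMeasure_uniformLaw hL
  set S := {p : (ι → ℝ) × ℝ | p.2 ∈ voidSet L (Set.range p.1) x}
  have hS : MeasurableSet S := measurableSet_setOf_mem_voidSet_range L x
  calc ∫⁻ ξ, volume (voidSet L (Set.range ξ) x) ∂Measure.pi (fun _ : ι => uniformLaw L)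
      = ((Measure.pi fun _ : ι => uniformLaw L).prod volume) S := (Measure.prod_apply hS).symm
    _ = ∫⁻ y, Measure.pi (fun _ : ι => uniformLaw L) {ξ | y ∈ voidSet L (Set.range ξ) x} :=
        Measure.prod_apply_symm hS
    _ = ENNReal.ofReal ((1 - x / L) ^ Fintype.card ι) * ENNReal.ofReal (L - x) := by
        simp only [pi_uniformLaw_setOf_mem_voidSet_range hL hx hxL]
        rw [lintegral_indicator_const measurableSet_Icc, Real.volume_Icc]
        ring_nf
    _ = ENNReal.ofReal (L * (1 - x / L) ^ (Fintype.card ι + 1)) := by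
        rw [← ENNReal.ofReal_mul' (by linarith), pow_succ]
        congr 1
        field_simp

lemma integral_voidFraction_range (hL : 0 < L) (hx : 0 ≤ x) (hxL : x ≤ L) :
    ∫ ξ, voidFraction L (Set.range ξ) x ∂Measure.pi (fun _ : ι => uniformLaw L)
      = (1 - x / L) ^ (Fintype.card ι + 1) := by
  have h0 : 0 ≤ 1 - x / L := sub_nonneg.2 ((div_le_one hL).2 hxL)
  simp only [voidFraction, measureReal_def]
  rw [integral_const_mul, integral_toReal (measurable_volume_voidSet_range L x).aemeasurable
    (Eventually.of_forall fun ξ => (volume_voidSet_ne_top _ _ _).lt_top),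
    lintegral_volume_voidSet_range hL hx hxL, ENNReal.toReal_ofReal (by positivity), one_div,
    inv_mul_cancel_left₀ hL.ne']

lemma measureReal_pi_uniformLaw_le_abs_voidFraction_sub_le {N : ℕ} {ε : ℝ} (hL : 0 < L)
    (hx : 0 ≤ x) (hxL : x ≤ L) (hε : 0 ≤ ε) :
    (Measure.pi fun _ : Fin N => uniformLaw L).real
        {ξ | ε ≤ |voidFraction L (Set.range ξ) x - (1 - x / L) ^ (N + 1)|}
      ≤ 2 * Real.exp (-ε ^ 2 / (2 * (N * (x / L / 2) ^ 2))) := by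
  have := isProbabilityMeasure_uniformLaw hL
  have hsub := hasSubgaussianMGF_of_hasBoundedDifferences (μ := fun _ : Fin N => uniformLaw L)
    (measurable_voidFraction_range L x) (B := 1) (fun ξ => abs_le.2
      ⟨by linarith [(voidFraction_mem_Icc hL (Set.range ξ) hx).1],
        (voidFraction_mem_Icc hL (Set.range ξ) hx).2⟩)
    (hasBoundedDifferences_voidFraction_range hL hx)
  rw [integral_voidFraction_range hL hx hxL, Fintype.card_fin] at hsub
  have hvar : ((∑ _i : Fin N, ((x / L).toNNReal / 2) ^ 2 : NNReal) : ℝ)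
      = N * (x / L / 2) ^ 2 := by
    simp [Real.coe_toNNReal (x / L) (by positivity)]
  rw [← hvar]
  exact measureReal_le_abs_le_of_hasSubgaussianMGF hsub hε

end Uniform

namespace IsUniformModel

variable {Ω : Type*} [MeasurableSpace Ω] {P : Measure Ω} {lam : ℝ} {L : ℕ → ℝ}
  {ξ : (n : ℕ) → Fin (n - 1) → Ω → ℝ}

lemma tendsto_length (h : IsUniformModel P lam L ξ) (hlam : 0 < lam) :
    Tendsto L atTop atTop := by
  have hmul : Tendsto (fun n : ℕ => ((n : ℝ) / L n)⁻¹ * n) atTop atTop :=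
    Tendsto.pos_mul_atTop (inv_pos.2 hlam) (h.concentration.inv₀ hlam.ne')
      tendsto_natCast_atTop_atTop
  refine hmul.congr' ?_
  filter_upwards [eventually_ne_atTop 0] with n hn
  rw [inv_div, div_mul_cancel₀ _ (Nat.cast_ne_zero.2 hn)]

lemma tendsto_one_sub_div_pow (h : IsUniformModel P lam L ξ) (x : ℝ) :
    Tendsto (fun n : ℕ => (1 - x / L n) ^ n) atTop (𝓝 (Real.exp (-(lam * x)))) := by
  have hmul : Tendsto (fun n : ℕ => (n : ℝ) * (-(x / L n))) atTop (𝓝 (-(lam * x))) :=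
    (h.concentration.mul_const x).neg.congr fun n => by ring
  simpa only [sub_eq_add_neg] using Real.tendsto_one_add_pow_exp_of_tendsto hmul

variable [IsProbabilityMeasure P]

lemma map_eq (h : IsUniformModel P lam L ξ) (n : ℕ) :
    P.map (fun ω i => ξ n i ω) = Measure.pi fun _ => uniformLaw (L n) := by
  rw [(iIndepFun_iff_map_fun_eq_pi_map fun i => (h.measurable_point n i).aemeasurable).1
    (h.indep_points n)]
  exact congrArg Measure.pi (funext (h.uniform_point n))

lemma measureReal_le_abs_voidFraction_sub_le (h : IsUniformModel P lam L ξ) {n : ℕ} (hn : n ≠ 0)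
    {x ε : ℝ} (hx : 0 ≤ x) (hxL : x ≤ L n) (hε : 0 ≤ ε) :
    P.real {ω | ε ≤ |voidFraction (L n) (Set.range fun i => ξ n i ω) x - (1 - x / L n) ^ n|}
      ≤ 2 * Real.exp (-ε ^ 2 / (2 * ((n - 1 : ℕ) * (x / L n / 2) ^ 2))) := by
  have htail := measureReal_pi_uniformLaw_le_abs_voidFraction_sub_le (N := n - 1)
    (h.length_pos n) hx hxL hε
  rwa [← h.map_eq n, map_measureReal_apply (measurable_pi_lambda _ (h.measurable_point n))
    (measurableSet_le measurable_const ((measurable_voidFraction_range _ _).sub_const _).abs),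
    Nat.sub_add_cancel (Nat.one_le_iff_ne_zero.2 hn)] at htail

lemma eventually_measureReal_le_abs_voidFraction_sub_le (h : IsUniformModel P lam L ξ)
    (hlam : 0 < lam) {x ε : ℝ} (hx : 0 < x) (hε : 0 < ε) :
    ∀ᶠ n in atTop,
      P.real {ω | ε ≤ |voidFraction (L n) (Set.range fun i => ξ n i ω) x - (1 - x / L n) ^ n|}
        ≤ 2 * Real.exp (-(ε ^ 2 / (2 * lam ^ 2 * x ^ 2))) ^ n := by
  filter_upwards [eventually_ge_atTop 2, (h.tendsto_length hlam).eventually_ge_atTop x,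
    h.concentration.eventually (gt_mem_nhds (show lam < 2 * lam by linarith))] with n hn hxL hc
  have hL := h.length_pos n
  have hnL : (n : ℝ) ≤ 2 * lam * L n := ((div_lt_iff₀ hL).1 hc).le
  have hn0 : (0 : ℝ) < n := Nat.cast_pos.2 (by omega)
  have hpred : (0 : ℝ) < (n - 1 : ℕ) := Nat.cast_pos.2 (by omega)
  have hpred_le : ((n - 1 : ℕ) : ℝ) ≤ n := Nat.cast_le.2 (Nat.sub_le n 1)
  refine (h.measureReal_le_abs_voidFraction_sub_le (by omega) hx.le hxL hε.le).trans ?_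
  rw [← Real.exp_nat_mul, neg_div, mul_neg]
  gcongr
  calc (n : ℝ) * (ε ^ 2 / (2 * lam ^ 2 * x ^ 2))
      = ε ^ 2 / (2 * (n * (x / (n / (2 * lam)) / 2) ^ 2)) := by field_simp
    _ ≤ ε ^ 2 / (2 * (n * (x / L n / 2) ^ 2)) := by
        gcongr
        rwa [div_le_iff₀' (by positivity)]
    _ ≤ ε ^ 2 / (2 * ((n - 1 : ℕ) * (x / L n / 2) ^ 2)) := by gcongr

lemma ae_tendsto_voidFraction (h : IsUniformModel P lam L ξ) (hlam : 0 < lam) {x : ℝ}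
    (hx : 0 < x) :
    ∀ᵐ ω ∂P, Tendsto (fun n => voidFraction (L n) (Set.range fun i => ξ n i ω) x) atTop
      (𝓝 (Real.exp (-(lam * x)))) := by
  have hdev : ∀ᵐ ω ∂P, Tendsto (fun n => voidFraction (L n) (Set.range fun i => ξ n i ω) x
      - (1 - x / L n) ^ n) atTop (𝓝 0) := by
    refine ae_tendsto_zero_of_forall_tsum_measure_ne_top fun ε hε => ?_
    have hgeom : Summable fun n : ℕ => 2 * Real.exp (-(ε ^ 2 / (2 * lam ^ 2 * x ^ 2))) ^ n :=
      (summable_geometric_of_lt_one (Real.exp_pos _).le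
        (Real.exp_lt_one_iff.2 (neg_lt_zero.2 (by positivity)))).mul_left 2
    have hsum := hgeom.of_norm_bounded_eventually_nat <|
      (h.eventually_measureReal_le_abs_voidFraction_sub_le hlam hx hε).mono fun n hn =>
        (Real.norm_of_nonneg measureReal_nonneg).trans_le hn
    simpa only [ofReal_measureReal (measure_ne_top P _)] using hsum.tsum_ofReal_ne_top
  filter_upwards [hdev] with ω hω
  simpa only [sub_add_cancel, zero_add] using hω.add (h.tendsto_one_sub_div_pow x)

theorem ae_hasPoissonVoids (h : IsUniformModel P lam L ξ) (hlam : 0 < lam) :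
    ∀ᵐ ω ∂P, HasPoissonVoids atTop L (fun n => Set.range fun i => ξ n i ω) lam := by
  have hrat : ∀ᵐ ω ∂P, ∀ q : ℚ, (0 : ℝ) < q → Tendsto (fun n =>
      voidFraction (L n) (Set.range fun i => ξ n i ω) q) atTop (𝓝 (Real.exp (-(lam * q)))) :=
    ae_all_iff.2 fun q => ae_all_iff.2 fun hq => h.ae_tendsto_voidFraction hlam hq
  filter_upwards [hrat] with ω hω
  exact .of_rat (Eventually.of_forall h.length_pos)
    (fun n => (Set.finite_range _).inter_of_left _) hω

end IsUniformModel

/-! ### Poisson impurities -/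

/-- The indicator of the event that `B` contains no impurity. -/
def voidInd (X B : Set ℝ) : ℝ := if (X ∩ B).encard = 0 then 1 else 0

/-- The window of `m` consecutive cells of the lattice of mesh `δ` that starts at the `k`-th lattice
point. -/
def window (δ : ℝ) (m : ℕ) (k : ℤ) : Set ℝ := Set.Ico (k * δ) ((k + m) * δ)

/-- The number of windows free of impurities among those that start in the `2 * K` cells around the
origin. -/
def voidCount (X : Set ℝ) (δ : ℝ) (m K : ℕ) : ℝ :=
  ∑ k ∈ Finset.Ico (-K : ℤ) K, voidInd X (window δ m k)

section Windows

variable {δ L : ℝ} {X : Set ℝ} {m K : ℕ}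

lemma volume_real_window (hδ : 0 ≤ δ) (m : ℕ) (k : ℤ) : volume.real (window δ m k) = m * δ := by
  have hle : (k : ℝ) * δ ≤ (k + m) * δ := by
    gcongr
    exact le_add_of_nonneg_right m.cast_nonneg
  rw [window, Real.volume_real_Ico_of_le hle, add_mul, add_sub_cancel_left]

lemma disjoint_window_of_add_le (hδ : 0 ≤ δ) {k k' : ℤ} (h : k + m ≤ k') :
    Disjoint (window δ m k) (window δ m k') := by
  have hle : ((k : ℝ) + m) * δ ≤ k' * δ := by
    gcongr
    exact_mod_cast h
  exact Set.disjoint_left.2 fun y hy hy' => (hy.2.trans_le hle).not_ge hy'.1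

lemma disjoint_window (hδ : 0 ≤ δ) {k k' : ℤ} (h : m ≤ |k - k'|) :
    Disjoint (window δ m k) (window δ m k') := by
  rcases le_abs.1 h with h | h
  · exact (disjoint_window_of_add_le hδ (by linarith)).symm
  · exact disjoint_window_of_add_le hδ (by linarith)

lemma voidCount_eq_card (X : Set ℝ) (δ : ℝ) (m K : ℕ) :
    voidCount X δ m K
      = ((Finset.Ico (-K : ℤ) K).filter fun k => (X ∩ window δ m k).encard = 0).card :=
  Finset.sum_boole _ _

lemma encard_inter_eq_zero_iff_disjoint {B : Set ℝ} : (X ∩ B).encard = 0 ↔ Disjoint B X := by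
  rw [Set.encard_eq_zero, ← Set.disjoint_iff_inter_eq_empty, disjoint_comm]

lemma exists_window_of_mem_voidSet (hδ : 0 < δ) (hm : 0 < m) (hK : L / 2 ≤ K * δ) {y : ℝ}
    (hy : y ∈ voidSet L X ((m + 1) * δ)) :
    ∃ k ∈ Finset.Ico (-K : ℤ) K, Disjoint (window δ m k) X ∧ y ∈ window δ 1 (k - 1) := by
  obtain ⟨hleft, hright, hvoid⟩ := hy
  have hfloor : (⌊y / δ⌋ : ℝ) * δ ≤ y := (le_div_iff₀ hδ).1 (Int.floor_le _)
  have hlt : y < (⌊y / δ⌋ + 1) * δ := (div_lt_iff₀ hδ).1 (Int.lt_floor_add_one _)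
  refine ⟨⌊y / δ⌋ + 1, Finset.mem_Ico.2 ⟨?_, ?_⟩, hvoid.mono_left fun z hz => ?_, ?_⟩
  · have : (-K : ℝ) * δ < (⌊y / δ⌋ + 1) * δ := by linarith
    exact_mod_cast (lt_of_mul_lt_mul_right this hδ.le).le
  · have : ((⌊y / δ⌋ : ℝ) + 1 + m) * δ ≤ K * δ := by linarith
    have : ⌊y / δ⌋ + 1 + (m : ℤ) ≤ K := by exact_mod_cast le_of_mul_le_mul_right this hδ
    omega
  · simp only [window, Set.mem_Ico, Int.cast_add, Int.cast_one] at hz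
    exact ⟨hlt.trans_le hz.1, by linarith [hz.2]⟩
  · simpa [window] using ⟨hfloor, hlt⟩

lemma volume_voidSet_le (hδ : 0 < δ) (hm : 0 < m) (hK : L / 2 ≤ K * δ) :
    volume.real (voidSet L X ((m + 1) * δ)) ≤ δ * voidCount X δ m K := by
  set T := (Finset.Ico (-K : ℤ) K).filter fun k => (X ∩ window δ m k).encard = 0
  have hsub : voidSet L X ((m + 1) * δ) ⊆ ⋃ k ∈ T, window δ 1 (k - 1) := fun y hy => by
    obtain ⟨k, hk, hvoid, hyk⟩ := exists_window_of_mem_voidSet hδ hm hK hy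
    exact Set.mem_biUnion
      (Finset.mem_filter.2 ⟨hk, encard_inter_eq_zero_iff_disjoint.2 hvoid⟩) hyk
  calc volume.real (voidSet L X ((m + 1) * δ))
      ≤ volume.real (⋃ k ∈ T, window δ 1 (k - 1)) := measureReal_mono hsub
        (measure_biUnion_lt_top T.finite_toSet fun _ _ => measure_Ico_lt_top).ne
    _ ≤ ∑ k ∈ T, volume.real (window δ 1 (k - 1)) := measureReal_biUnion_finset_le _ _
    _ = δ * voidCount X δ m K := by
        simp only [volume_real_window hδ.le, Nat.cast_one, one_mul, Finset.sum_const, nsmul_eq_mul,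
          voidCount_eq_card, mul_comm δ, T]

lemma window_one_subset_voidSet_union (hδ : 0 < δ) (hK : K * δ ≤ L / 2) {k : ℤ}
    (hk : k ∈ Finset.Ico (-K : ℤ) K) (hvoid : Disjoint (window δ (m + 1) k) X) :
    window δ 1 k ⊆ voidSet L X (m * δ) ∪ Set.Icc (L / 2 - (m + 1) * δ) (L / 2) := by
  rintro y ⟨hky, hyk⟩
  rw [Finset.mem_Ico] at hk
  have hleft : (-K : ℝ) * δ ≤ k * δ := by gcongr; exact_mod_cast hk.1
  have hright : ((k : ℝ) + 1) * δ ≤ K * δ := by gcongr; exact_mod_cast hk.2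
  rw [Nat.cast_one] at hyk
  rcases le_or_gt ((k + (m + 1)) * δ) (L / 2) with h | h
  · refine Or.inl ⟨by linarith, by linarith, hvoid.mono_left fun z hz => ?_⟩
    refine ⟨hky.trans hz.1.le, ?_⟩
    push_cast
    linarith [hz.2]
  · exact Or.inr ⟨by linarith, by linarith⟩

lemma voidCount_le_volume_voidSet (hδ : 0 < δ) (hK : K * δ ≤ L / 2) :
    δ * voidCount X δ (m + 1) K ≤ volume.real (voidSet L X (m * δ)) + (m + 1) * δ := by
  set T := (Finset.Ico (-K : ℤ) K).filter fun k => (X ∩ window δ (m + 1) k).encard = 0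
  have hdisj : Set.PairwiseDisjoint (T : Set ℤ) (window δ 1) := fun k _ k' _ hkk' =>
    disjoint_window hδ.le (by exact_mod_cast Int.one_le_abs (sub_ne_zero.2 hkk'))
  have hsub : ⋃ k ∈ T, window δ 1 k
      ⊆ voidSet L X (m * δ) ∪ Set.Icc (L / 2 - (m + 1) * δ) (L / 2) :=
    Set.iUnion₂_subset fun k hk => window_one_subset_voidSet_union hδ hK
      (Finset.mem_filter.1 hk).1
      (encard_inter_eq_zero_iff_disjoint.1 (Finset.mem_filter.1 hk).2)
  have hboundary : L / 2 - (m + 1) * δ ≤ L / 2 := sub_le_self _ (by positivity)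
  calc δ * voidCount X δ (m + 1) K = ∑ k ∈ T, volume.real (window δ 1 k) := by
        simp only [volume_real_window hδ.le, Nat.cast_one, one_mul, Finset.sum_const, nsmul_eq_mul,
          voidCount_eq_card, mul_comm δ, T]
    _ = volume.real (⋃ k ∈ T, window δ 1 k) := (measureReal_biUnion_finset hdisj
        (fun _ _ => measurableSet_Ico) fun _ _ => measure_Ico_lt_top.ne).symm
    _ ≤ volume.real (voidSet L X (m * δ) ∪ Set.Icc (L / 2 - (m + 1) * δ) (L / 2)) :=
        measureReal_mono hsub
          (measure_union_lt_top (volume_voidSet_ne_top _ _ _).lt_top measure_Icc_lt_top).ne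
    _ ≤ volume.real (voidSet L X (m * δ)) + volume.real (Set.Icc (L / 2 - (m + 1) * δ) (L / 2)) :=
        measureReal_union_le _ _
    _ = volume.real (voidSet L X (m * δ)) + (m + 1) * δ := by
        rw [Real.volume_real_Icc_of_le hboundary, sub_sub_cancel]

lemma tendsto_mul_voidCount_div {p : ℝ} (hδ : 0 < δ) (hm : 0 < m)
    (h : Tendsto (fun M : ℕ => voidCount X δ m (m * M) / M) atTop (𝓝 (2 * m * p)))
    {M : ℝ → ℕ} (hM : Tendsto M atTop atTop)
    (hML : Tendsto (fun L => (M L : ℝ) / L) atTop (𝓝 (1 / (2 * m * δ)))) :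
    Tendsto (fun L => 1 / L * (δ * voidCount X δ m (m * M L))) atTop (𝓝 p) := by
  have hmul := ((h.comp hM).mul hML).const_mul δ
  have hm' : (m : ℝ) ≠ 0 := Nat.cast_ne_zero.2 hm.ne'
  have hp : δ * (2 * m * p * (1 / (2 * m * δ))) = p := by field_simp
  rw [hp] at hmul
  refine hmul.congr' ?_
  filter_upwards [hM.eventually_ne_atTop 0] with L hL
  have hL' : (M L : ℝ) ≠ 0 := Nat.cast_ne_zero.2 hL
  simp only [Function.comp_apply]
  field_simp

lemma eventually_voidFraction_lt {p b : ℝ} (hδ : 0 < δ) (hm : 0 < m)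
    (h : Tendsto (fun M : ℕ => voidCount X δ m (m * M) / M) atTop (𝓝 (2 * m * p))) (hb : p < b) :
    ∀ᶠ L in atTop, voidFraction L X ((m + 1) * δ) < b := by
  have ha : 0 < 1 / (2 * m * δ) := by positivity
  have hlim := tendsto_mul_voidCount_div hδ hm h (M := fun L => ⌈1 / (2 * m * δ) * L⌉₊)
    (tendsto_nat_ceil_atTop.comp (tendsto_id.const_mul_atTop ha))
    (tendsto_nat_ceil_mul_div_atTop ha.le)
  filter_upwards [hlim.eventually (gt_mem_nhds hb), eventually_gt_atTop 0] with L hlt hL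
  have hceil := Nat.le_ceil (1 / (2 * m * δ) * L)
  rw [one_div_mul_eq_div, div_le_iff₀ (by positivity)] at hceil
  refine lt_of_le_of_lt ?_ hlt
  unfold voidFraction
  gcongr
  refine volume_voidSet_le hδ hm ?_
  push_cast
  rw [one_div_mul_eq_div]
  linarith

lemma eventually_lt_voidFraction {p a : ℝ} (hδ : 0 < δ)
    (h : Tendsto (fun M : ℕ => voidCount X δ (m + 1) ((m + 1) * M) / M) atTop
      (𝓝 (2 * (m + 1 : ℕ) * p))) (ha : a < p) :
    ∀ᶠ L in atTop, a < voidFraction L X (m * δ) := by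
  have hc : 0 < 1 / (2 * (m + 1 : ℕ) * δ) := by positivity
  have hcount := tendsto_mul_voidCount_div hδ m.succ_pos h
    (M := fun L => ⌊1 / (2 * (m + 1 : ℕ) * δ) * L⌋₊)
    (tendsto_nat_floor_atTop.comp (tendsto_id.const_mul_atTop hc))
    (tendsto_nat_floor_mul_div_atTop hc.le)
  have hboundary : Tendsto (fun L : ℝ => (m + 1) * δ / L) atTop (𝓝 0) :=
    tendsto_const_nhds.div_atTop tendsto_id
  have hlim := hcount.sub hboundary
  rw [sub_zero] at hlim
  filter_upwards [hlim.eventually (lt_mem_nhds ha), eventually_gt_atTop 0] with L hlt hL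
  have hfloor := Nat.floor_le (a := 1 / (2 * (m + 1 : ℕ) * δ) * L) (by positivity)
  rw [one_div_mul_eq_div, le_div_iff₀ (by positivity)] at hfloor
  refine hlt.trans_le ?_
  have hdiv : (m + 1) * δ / L = 1 / L * ((m + 1) * δ) := by ring
  rw [voidFraction, hdiv, ← mul_sub]
  gcongr
  refine sub_le_iff_le_add.2 (voidCount_le_volume_voidSet hδ ?_)
  push_cast at hfloor ⊢
  rw [one_div_mul_eq_div]
  linarith

lemma tendsto_voidFraction_of_tendsto_voidCount {lam x : ℝ} (hx : 0 < x)
    (h : ∀ k m : ℕ, Tendsto (fun M : ℕ => voidCount X (x / (k + 1)) m (m * M) / M) atTop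
      (𝓝 (2 * m * Real.exp (-(lam * (m * (x / (k + 1)))))))) :
    Tendsto (fun L => voidFraction L X x) atTop (𝓝 (Real.exp (-(lam * x)))) := by
  have hvanish : Tendsto (fun k : ℕ => x / ((k : ℝ) + 1)) atTop (𝓝 0) :=
    tendsto_const_nhds.div_atTop (tendsto_natCast_atTop_atTop.atTop_add tendsto_const_nhds)
  have hexp : ∀ {u : ℕ → ℝ}, Tendsto u atTop (𝓝 x) →
      Tendsto (fun k => Real.exp (-(lam * u k))) atTop (𝓝 (Real.exp (-(lam * x)))) := fun hu =>
    (Real.continuous_exp.tendsto _).comp (hu.const_mul lam).neg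
  refine tendsto_order.2 ⟨fun a ha => ?_, fun b hb => ?_⟩
  · have hwide : Tendsto (fun k : ℕ => ((k + 1 + 1 : ℕ) : ℝ) * (x / (k + 1))) atTop (𝓝 x) := by
      refine (add_zero x ▸ hvanish.const_add x).congr fun k => ?_
      push_cast
      field_simp
    obtain ⟨k, hk⟩ := ((hexp hwide).eventually (lt_mem_nhds ha)).exists
    have hlow := eventually_lt_voidFraction (by positivity) (h k (k + 1 + 1)) hk
    have hmul : ((k + 1 : ℕ) : ℝ) * (x / (k + 1)) = x := by push_cast; field_simp
    rwa [hmul] at hlow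
  · have hnarrow : Tendsto (fun k : ℕ => (k : ℝ) * (x / (k + 1))) atTop (𝓝 x) := by
      refine (sub_zero x ▸ hvanish.const_sub x).congr fun k => ?_
      field_simp
      ring
    obtain ⟨k, hk, hk0⟩ :=
      (((hexp hnarrow).eventually (gt_mem_nhds hb)).and (eventually_gt_atTop 0)).exists
    have hup := eventually_voidFraction_lt (by positivity) hk0 (h k k) hk
    have hmul : ((k : ℝ) + 1) * (x / (k + 1)) = x := by field_simp
    rwa [hmul] at hup

end Windows

lemma sum_Ico_neg_natCast (f : ℤ → ℝ) (K : ℕ) : ∑ k ∈ Finset.Ico (-K : ℤ) K, f k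
    = ∑ k ∈ Finset.range K, f k + ∑ k ∈ Finset.range K, f (-(k + 1)) := by
  induction K with
  | zero => simp
  | succ K ih =>
    have hinsert : Finset.Ico (-(K + 1 : ℕ) : ℤ) (K + 1 : ℕ)
        = insert (K : ℤ) (insert (-(K + 1) : ℤ) (Finset.Ico (-K : ℤ) K)) := by
      ext k
      simp only [Finset.mem_insert, Finset.mem_Ico]
      omega
    rw [hinsert, Finset.sum_insert (by simp; omega), Finset.sum_insert (by simp), ih,
      Finset.sum_range_succ, Finset.sum_range_succ]
    ring

lemma sum_range_mul_eq (a : ℕ → ℝ) (m M : ℕ) : ∑ k ∈ Finset.range (m * M), a k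
    = ∑ r ∈ Finset.range m, ∑ j ∈ Finset.range M, a (m * j + r) := by
  induction M with
  | zero => simp
  | succ M ih =>
    rw [Nat.mul_succ, Finset.sum_range_add, ih, ← Finset.sum_add_distrib]
    exact Finset.sum_congr rfl fun r _ => (Finset.sum_range_succ _ _).symm

lemma identDistrib_indicator_one {Ω : Type*} [MeasurableSpace Ω] {P : Measure Ω}
    [IsProbabilityMeasure P] {A B : Set Ω} (hA : MeasurableSet A) (hB : MeasurableSet B)
    (h : P A = P B) :
    IdentDistrib (A.indicator fun _ => (1 : ℝ)) (B.indicator fun _ => (1 : ℝ)) P P := by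
  classical
  have hAm : Measurable (A.indicator fun _ => (1 : ℝ)) := measurable_const.indicator hA
  have hBm : Measurable (B.indicator fun _ => (1 : ℝ)) := measurable_const.indicator hB
  refine ⟨hAm.aemeasurable, hBm.aemeasurable, ?_⟩
  have hcompl : P Aᶜ = P Bᶜ := by rw [prob_compl_eq_one_sub hA, prob_compl_eq_one_sub hB, h]
  ext s hs
  rw [Measure.map_apply hAm hs, Measure.map_apply hBm hs, Set.indicator_const_preimage_eq_union,
    Set.indicator_const_preimage_eq_union]
  split_ifs <;> simp [h, hcompl]

lemma voidInd_eq_indicator {Ω : Type*} (X : Ω → Set ℝ) (B : Set ℝ) :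
    (fun ω => voidInd (X ω) B) = {ω | (X ω ∩ B).encard = 0}.indicator fun _ => (1 : ℝ) := by
  funext ω
  simp only [voidInd, Set.indicator, Set.mem_ofPred_eq]

namespace IsPoissonProcess

variable {Ω : Type*} [MeasurableSpace Ω] {P : Measure Ω} {lam : ℝ} {X : Ω → Set ℝ}

lemma measurableSet_encard_inter_eq (h : IsPoissonProcess P lam X) {B : Set ℝ}
    (hB : MeasurableSet B) (hb : Bornology.IsBounded B) (m : ℕ∞) :
    MeasurableSet {ω | (X ω ∩ B).encard = m} :=
  h.measurable_count B hB hb (measurableSet_singleton m)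

lemma measure_encard_inter_eq_zero (h : IsPoissonProcess P lam X) {B : Set ℝ}
    (hB : MeasurableSet B) (hb : Bornology.IsBounded B) :
    P {ω | (X ω ∩ B).encard = 0} = ENNReal.ofReal (Real.exp (-(lam * volume.real B))) := by
  simpa using h.law_count B hB hb 0

lemma indepFun_voidInd (h : IsPoissonProcess P lam X) {B C : Set ℝ} (hB : MeasurableSet B)
    (hC : MeasurableSet C) (hb : Bornology.IsBounded B) (hc : Bornology.IsBounded C)
    (hBC : Disjoint B C) :
    IndepFun (fun ω => voidInd (X ω) B) (fun ω => voidInd (X ω) C) P := by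
  have hindep := h.indep_count 2 ![B, C] (Fin.forall_fin_two.2 ⟨hB, hC⟩)
    (Fin.forall_fin_two.2 ⟨hb, hc⟩) fun i j hij => by
      fin_cases i <;> fin_cases j
      exacts [(hij rfl).elim, hBC, hBC.symm, (hij rfl).elim]
  have hmeas : Measurable fun c : ℕ∞ => if c = 0 then (1 : ℝ) else 0 := measurable_from_top
  exact (hindep.indepFun zero_ne_one).comp hmeas hmeas

lemma tsum_measure_encard_inter_eq (h : IsPoissonProcess P lam X) (hlam : 0 ≤ lam) {B : Set ℝ}
    (hB : MeasurableSet B) (hb : Bornology.IsBounded B) :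
    ∑' m : ℕ, P {ω | (X ω ∩ B).encard = m} = 1 := by
  have hmean : 0 ≤ lam * volume.real B := by positivity
  have hpoisson := hasSum_one_poissonMeasure (lam * volume.real B).toNNReal
  rw [Real.coe_toNNReal _ hmean] at hpoisson
  simp only [h.law_count B hB hb]
  rw [← ENNReal.ofReal_one, ← hpoisson.tsum_eq,
    ENNReal.ofReal_tsum_of_nonneg (fun m => by positivity) hpoisson.summable]
  simp only [mul_comm (Real.exp _), mul_div_right_comm]

variable [IsProbabilityMeasure P]

lemma ae_tendsto_average_voidInd (h : IsPoissonProcess P lam X) {B : ℕ → Set ℝ}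
    (hB : ∀ j, MeasurableSet (B j)) (hb : ∀ j, Bornology.IsBounded (B j))
    (hd : Pairwise fun i j => Disjoint (B i) (B j)) {v : ℝ} (hv : ∀ j, volume.real (B j) = v) :
    ∀ᵐ ω ∂P, Tendsto (fun M : ℕ => (∑ j ∈ Finset.range M, voidInd (X ω) (B j)) / M) atTop
      (𝓝 (Real.exp (-(lam * v)))) := by
  have hmeas (j : ℕ) := h.measurableSet_encard_inter_eq (hB j) (hb j) 0
  have hprob (j : ℕ) : P {ω | (X ω ∩ B j).encard = 0}
      = ENNReal.ofReal (Real.exp (-(lam * v))) :=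
    hv j ▸ h.measure_encard_inter_eq_zero (hB j) (hb j)
  have hmean : ∫ ω, voidInd (X ω) (B 0) ∂P = Real.exp (-(lam * v)) := by
    rw [voidInd_eq_indicator, integral_indicator_const _ (hmeas 0), measureReal_def, hprob,
      ENNReal.toReal_ofReal (Real.exp_pos _).le, smul_eq_mul, mul_one]
  rw [← hmean]
  refine strong_law_ae_real (fun j ω => voidInd (X ω) (B j)) ?_
    (fun i j hij => h.indepFun_voidInd (hB i) (hB j) (hb i) (hb j) (hd hij)) fun j => ?_
  · simp only [voidInd_eq_indicator]
    exact (integrable_const 1).indicator (hmeas 0)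
  · simp only [voidInd_eq_indicator]
    exact identDistrib_indicator_one (hmeas j) (hmeas 0) ((hprob j).trans (hprob 0).symm)

lemma ae_tendsto_sum_voidInd_window (h : IsPoissonProcess P lam X) {δ : ℝ} (hδ : 0 ≤ δ) (m : ℕ)
    {k : ℕ → ℤ} (hk : ∀ i j, |k i - k j| = |(i : ℤ) - j|) :
    ∀ᵐ ω ∂P, Tendsto
      (fun M : ℕ => (∑ j ∈ Finset.range (m * M), voidInd (X ω) (window δ m (k j))) / M) atTop
      (𝓝 (m * Real.exp (-(lam * (m * δ))))) := by
  have hclass : ∀ᵐ ω ∂P, ∀ r : ℕ, Tendsto (fun M : ℕ =>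
      (∑ j ∈ Finset.range M, voidInd (X ω) (window δ m (k (m * j + r)))) / M) atTop
      (𝓝 (Real.exp (-(lam * (m * δ))))) := ae_all_iff.2 fun r =>
    h.ae_tendsto_average_voidInd (fun _ => measurableSet_Ico) (fun _ => Metric.isBounded_Ico _ _)
      (fun i j hij => disjoint_window hδ (by
        have hfar : 1 ≤ |(i : ℤ) - j| := Int.one_le_abs (sub_ne_zero.2 (by exact_mod_cast hij))
        rw [hk]
        push_cast
        rw [add_sub_add_right_eq_sub, ← mul_sub, abs_mul, Nat.abs_cast]
        exact le_mul_of_one_le_right (by positivity) hfar))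
      fun _ => volume_real_window hδ m _
  filter_upwards [hclass] with ω hω
  have hsum := tendsto_finsetSum (Finset.range m) fun r _ => hω r
  rw [Finset.sum_const, Finset.card_range, nsmul_eq_mul] at hsum
  exact hsum.congr fun M => by rw [sum_range_mul_eq, Finset.sum_div]

lemma ae_tendsto_voidCount (h : IsPoissonProcess P lam X) {δ : ℝ} (hδ : 0 ≤ δ) (m : ℕ) :
    ∀ᵐ ω ∂P, Tendsto (fun M : ℕ => voidCount (X ω) δ m (m * M) / M) atTop
      (𝓝 (2 * m * Real.exp (-(lam * (m * δ))))) := by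
  have hright := h.ae_tendsto_sum_voidInd_window hδ m (k := fun j => j) fun i j => rfl
  have hleft := h.ae_tendsto_sum_voidInd_window hδ m (k := fun j => -(j + 1)) fun i j => by
    rw [abs_sub_comm]
    ring_nf
  filter_upwards [hright, hleft] with ω hr hl
  have hsum := hr.add hl
  rw [← two_mul, ← mul_assoc] at hsum
  refine hsum.congr fun M => ?_
  rw [voidCount, sum_Ico_neg_natCast, add_div]

lemma ae_tendsto_voidFraction (h : IsPoissonProcess P lam X) {x : ℝ} (hx : 0 < x) :
    ∀ᵐ ω ∂P, Tendsto (fun L => voidFraction L (X ω) x) atTop (𝓝 (Real.exp (-(lam * x)))) := by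
  have hcount : ∀ᵐ ω ∂P, ∀ k m : ℕ,
      Tendsto (fun M : ℕ => voidCount (X ω) (x / (k + 1)) m (m * M) / M) atTop
        (𝓝 (2 * m * Real.exp (-(lam * (m * (x / (k + 1))))))) :=
    ae_all_iff.2 fun k => ae_all_iff.2 fun m => h.ae_tendsto_voidCount (by positivity) m
  filter_upwards [hcount] with ω hω
  exact tendsto_voidFraction_of_tendsto_voidCount hx hω

lemma ae_finite_inter (h : IsPoissonProcess P lam X) (hlam : 0 ≤ lam) {B : Set ℝ}
    (hB : MeasurableSet B) (hb : Bornology.IsBounded B) : ∀ᵐ ω ∂P, (X ω ∩ B).Finite := by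
  have hmeas (m : ℕ) := h.measurableSet_encard_inter_eq hB hb m
  have hdisj : Pairwise fun m n : ℕ =>
      Disjoint {ω | (X ω ∩ B).encard = m} {ω | (X ω ∩ B).encard = n} := fun m n hmn =>
    Set.disjoint_left.2 fun ω hm hn => hmn (Nat.cast_injective (hm.symm.trans hn))
  have hone : P (⋃ m : ℕ, {ω | (X ω ∩ B).encard = m}) = 1 :=
    (measure_iUnion hdisj hmeas).trans (h.tsum_measure_encard_inter_eq hlam hB hb)
  filter_upwards [(mem_ae_iff_prob_eq_one (MeasurableSet.iUnion hmeas)).2 hone] with ω hω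
  obtain ⟨m, hm⟩ := Set.mem_iUnion.1 hω
  exact Set.finite_of_encard_eq_coe hm

lemma ae_finite_inter_Ioo (h : IsPoissonProcess P lam X) (hlam : 0 ≤ lam) :
    ∀ᵐ ω ∂P, ∀ L : ℝ, (X ω ∩ Set.Ioo (-(L / 2)) (L / 2)).Finite := by
  have hnat : ∀ᵐ ω ∂P, ∀ k : ℕ, (X ω ∩ Set.Ioo (-(k : ℝ)) k).Finite :=
    ae_all_iff.2 fun k => h.ae_finite_inter hlam measurableSet_Ioo (Metric.isBounded_Ioo _ _)
  filter_upwards [hnat] with ω hω L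
  obtain ⟨k, hk⟩ := exists_nat_ge (L / 2)
  exact (hω k).subset (Set.inter_subset_inter_right _ (Set.Ioo_subset_Ioo (by linarith) hk))

theorem ae_hasPoissonVoids (h : IsPoissonProcess P lam X) (hlam : 0 ≤ lam) :
    ∀ᵐ ω ∂P, HasPoissonVoids atTop (fun L : ℝ => L) (fun _ => X ω) lam := by
  have hrat : ∀ᵐ ω ∂P, ∀ q : ℚ, (0 : ℝ) < q →
      Tendsto (fun L => voidFraction L (X ω) q) atTop (𝓝 (Real.exp (-(lam * q)))) :=
    ae_all_iff.2 fun q => ae_all_iff.2 fun hq => h.ae_tendsto_voidFraction hq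
  filter_upwards [hrat, h.ae_finite_inter_Ioo hlam] with ω hω hfin
  exact .of_rat (eventually_gt_atTop 0) hfin hω

end IsPoissonProcess

end LuttingerSy

end

theorem mainTheorem5 {Ω : Type*} [MeasurableSpace Ω] (P : Measure Ω) [IsProbabilityMeasure P]
    (lam β ρ : ℝ) (hlam : 0 < lam) (hβ : 0 < β) (hρ : 0 < ρ) :
    -- the limit that defines the critical density exists
    Tendsto (fun μ => LuttingerSy.rho lam β μ) (𝓝[<] (0 : ℝ)) (𝓝 (LuttingerSy.rhoCrit lam β)) ∧
    -- Poisson impurities on the line, volumes `[-L/2, L/2]` with `L → ∞`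
    (∀ X : Ω → Set ℝ, LuttingerSy.IsPoissonProcess P lam X →
      LuttingerSy.CondensationAsymptotics P (atTop : Filter ℝ) (fun L => L) (fun _ ω => X ω)
        lam β ρ) ∧
    -- `n - 1` independent uniform impurities in volumes of length `L n`, `n → ∞`, `n / L n → lam`
    (∀ (L : ℕ → ℝ) (ξ : (n : ℕ) → Fin (n - 1) → Ω → ℝ), LuttingerSy.IsUniformModel P lam L ξ →
      LuttingerSy.CondensationAsymptotics P (atTop : Filter ℕ) L
        (fun n ω => Set.range (fun i => ξ n i ω)) lam β ρ) := by
  refine ⟨?_, fun X hX => ?_, fun L ξ h => ?_⟩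
  · rw [LuttingerSy.rhoCrit_eq hlam hβ]
    exact LuttingerSy.tendsto_rho_zero hlam hβ
  · exact LuttingerSy.condensationAsymptotics_of_hasPoissonVoids hlam hβ hρ
      (hX.ae_hasPoissonVoids hlam.le)
  · exact LuttingerSy.condensationAsymptotics_of_hasPoissonVoids hlam hβ hρ
      (h.ae_hasPoissonVoids hlam)
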